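/- Let $X_1,X_2,\dots$ be i.i.d. random variables whose law has a density $f$ supported on $[0,1]$. For $c\in\mathbb R$, a positive sequence $(v_n)_{n\ge1}$ is in $\mathcal{GS}(c)$ if $\lim_{n\to\infty} n\,[1-v_{n-1}/v_n]=c$. Assume: (A1) $f$ has a continuous fourth derivative on $[0,1]$; (A2) $(\gamma_n)\in\mathcal{GS}(-\alpha)$ with $\alpha\in(\tfrac12,1]$; (A3) $(m_n)\in\mathcal{GS}(a)$ with $a\in(0,1)$; (A4) $n\gamma_n$ converges to a limit in $(\min\{2a,(2\alpha-a)/4\},\infty]$; put $\xi=\lim_{n\to\infty}(n\gamma_n)^{-1}$. The Bernstein order used at step $n$ is an even positive integer $N_n$ with $N_n/m_n\to1$. With $b_k(m,x)=\binom mk x^k(1-x)^{m-k}$ put $$T_{n,m}(x)=m\sum_{k=0}^{m-1}\mathbf 1\{k/m<X_n\le (k+1)/m\}\,b_k(m-1,x),\qquad Z_n(x)=2T_{n,N_n}(x)-T_{n,N_n/2}(x),$$ and define the recursive estimator by $f_0=0$, $f_n(x)=(1-\gamma_n)f_{n-1}(x)+\gamma_nZ_n(x)$ for $n\ge1$. Let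 $\mathrm{MISE}[f_n]=\mathbb E\int_0^1(f_n(x)-f(x))^2dx$, and $$\Delta_2(x)=\tfrac16(1-6x(1-x))f''(x)+\tfrac5{12}x(1-x)(1-2x)f^{(3)}(x)+\tfrac18x^2(1-x)^2f^{(4)}(x),\qquad \psi(x)=(4\pi x(1-x))^{-1/2},$$ $$C_1=\int_0^1f\psi\,dx,\qquad C_2=\int_0^1\Delta_2^2\,dx,\qquad C_3=\tfrac1{\sqrt2}+4\Bigl(1-\sqrt{\tfrac23}\Bigr).$$ Then $(f_n-f)^2$ is integrable with respect to $\mathbb P\otimes dx$ on $\Omega\times[0,1]$ for every $n$, where $\Omega$ is the underlying probability space, and, as $n\to\infty$: 1. if $a<\tfrac29\alpha$, then $\mathrm{MISE}[f_n]=C_2m_n^{-4}\dfrac{4}{(1-2a\xi)^2}+o(m_n^{-4})$; 2. if $a=\tfrac29\alpha$, then $\mathrm{MISE}[f_n]=C_2m_n^{-4}\dfrac{4}{(1-2a\xi)^2}+C_1C_3\gamma_nm_n^{1/2}\dfrac{2}{4-(2\alpha-a)\xi}+o\bigl(m_n^{-4}+\gamma_nm_n^{1/2}\bigr)$; 3.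 if $a>\tfrac29\alpha$, then $\mathrm{MISE}[f_n]=C_1C_3\gamma_nm_n^{1/2}\dfrac{2}{4-(2\alpha-a)\xi}+o\bigl(\gamma_nm_n^{1/2}\bigr)$. -/

import Mathlib

open MeasureTheory ProbabilityTheory Filter Topology Asymptotics

noncomputable section

namespace RecBernstein

/-- The class `GS(c)` of positive sequences `(v_n)_{n ≥ 1}` with `n (1 - v_{n-1} / v_n) → c`
(the value `v 0` plays no role). -/
def GS (c : ℝ) (v : ℕ → ℝ) : Prop :=
  (∀ n, 1 ≤ n → 0 < v n) ∧
    Tendsto (fun n : ℕ => (n : ℝ) * (1 - v (n - 1) / v n)) atTop (𝓝 c)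

/-- `T_m(y; x) = m ∑_{k=0}^{m-1} 1{k/m < y ≤ (k+1)/m} b_k(m-1, x)`, where `y` is an observation and
`b_k(m, x) = (m choose k) x^k (1-x)^(m-k)`. -/
def T (m : ℕ) (y x : ℝ) : ℝ :=
  (m : ℝ) * ∑ k ∈ Finset.range m,
    (Set.Ioc ((k : ℝ) / m) (((k : ℝ) + 1) / m)).indicator (fun _ => (1 : ℝ)) y *
      (bernsteinPolynomial ℝ (m - 1) k).eval x

/-- `Z = 2 T_m - T_{m/2}`, used for even `m`. -/
def Z (m : ℕ) (y x : ℝ) : ℝ := 2 * T m y x - T (m / 2) y x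

/-- The recursive estimator: `f_0 = 0` and `f_n = (1 - γ_n) f_{n-1} + γ_n Z_n` for `n ≥ 1`, where
`Z_n` is built from the `n`-th observation `y n` with order `N n`. -/
def estimator (γ : ℕ → ℝ) (N : ℕ → ℕ) (y : ℕ → ℝ) : ℕ → ℝ → ℝ
  | 0, _ => 0
  | n + 1, x => (1 - γ (n + 1)) * estimator γ N y n x + γ (n + 1) * Z (N (n + 1)) (y (n + 1)) x

/-- The mean integrated squared error `E ∫_0^1 (f_n(x) - f(x))^2 dx`. -/
def MISE {Ω : Type*} [MeasurableSpace Ω] (P : Measure Ω) (f : ℝ → ℝ) (X : ℕ → Ω → ℝ)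
    (γ : ℕ → ℝ) (N : ℕ → ℕ) (n : ℕ) : ℝ :=
  ∫ ω, (∫ x in (0 : ℝ)..1, (estimator γ N (fun i => X i ω) n x - f x) ^ 2) ∂P

/-- The `j`-th derivative of `f` on `[0,1]` (one-sided at the end points). -/
def D (j : ℕ) (f : ℝ → ℝ) (x : ℝ) : ℝ := iteratedDerivWithin j f (Set.Icc 0 1) x

def Δ₂ (f : ℝ → ℝ) (x : ℝ) : ℝ :=
  1 / 6 * (1 - 6 * x * (1 - x)) * D 2 f x
    + 5 / 12 * x * (1 - x) * (1 - 2 * x) * D 3 f x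
    + 1 / 8 * x ^ 2 * (1 - x) ^ 2 * D 4 f x

def ψ (x : ℝ) : ℝ := (4 * Real.pi * x * (1 - x)) ^ (-(1 / 2) : ℝ)

def C₁ (f : ℝ → ℝ) : ℝ := ∫ x in (0 : ℝ)..1, f x * ψ x

def C₂ (f : ℝ → ℝ) : ℝ := ∫ x in (0 : ℝ)..1, Δ₂ f x ^ 2

def C₃ : ℝ := 1 / √2 + 4 * (1 - √(2 / 3))

end RecBernstein

end

namespace RecBernstein

/-! By independence, the mean and variance of `f_n(x)` satisfy exact scalar recursions, and Fubini
splits the MISE into the integrated squared bias plus the integrated variance (`MISE_eq`). Both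
recursions have the form u_{n+1} = (1-γ)^s u_n + γ w c, with s = 1 for the bias and s = 2 for the
integrated variance, where w lies in a class `GS` and c converges. Everything therefore reduces to
an averaging lemma and two one-step asymptotics.

Averaging (`tendsto_averaging`): if w is in GS(-κ), then (1-γ_n)^s w_{n-1}/w_n = 1 - γ_n q_n with
q_n → s - κξ. The ratio u/w is thus pulled towards its fixed point c'/(s - κξ), and the initial
value is forgotten because the sum of the γ_n diverges. The factors 1-2aξ and 4-(2α-a)ξ arise here,
and the threshold on the limit of nγ_n is what keeps the relevant ones positive.

One-step bias (`smooth_expansion`, `tendsto_meanZ_bias`): central moments of the binomial law and a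
fourth-order Taylor expansion give E T_m = f + b/m + Δ₂/m² + o(m⁻²), uniformly on [0,1]. The
combination 2T_m - T_{m/2} cancels the 1/m term and leaves -2Δ₂/m².

One-step variance (`integral_Z_sq`, `tendsto_integral_Z_sq`, `tendsto_varZ`): for a fixed
observation y, the integral of Z² over x is an explicit combination of ratios of binomial
coefficients, because a product of Bernstein polynomials is a multiple of a Bernstein polynomial.
Stirling's formula turns these ratios into multiples of ψ(y), with total constant C₃. Dominated
convergence in y then gives the limit C₁C₃ on the scale √m; no pointwise variance asymptotics near
the end points are needed.

The three cases compare m⁻⁴ with γ√m. In each of the two strict cases the negligible part is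
averaged on the scale of the dominant one, where its forcing term tends to 0. -/

/-! ### Contraction recursions and uniform convergence. -/

theorem tendsto_zero_of_le_contraction {E a δ : ℕ → ℝ} (hE : ∀ n, 0 ≤ E n)
    (ha0 : ∀ᶠ n in atTop, 0 ≤ a n) (ha1 : ∀ᶠ n in atTop, a n ≤ 1)
    (hsum : Tendsto (fun n => ∑ i ∈ Finset.range n, a i) atTop atTop)
    (hδ : Tendsto δ atTop (𝓝 0))
    (hrec : ∀ᶠ n in atTop, E (n + 1) ≤ (1 - a n) * E n + a n * δ n) :
    Tendsto E atTop (𝓝 0) := by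
  rw [Metric.tendsto_atTop]
  intro ε hε
  have hδ' : ∀ᶠ n in atTop, δ n ≤ ε / 2 :=
    (hδ.eventually (gt_mem_nhds (half_pos hε))).mono fun n hn => hn.le
  obtain ⟨n₀, h₀⟩ := eventually_atTop.1 (ha0.and (ha1.and (hrec.and hδ')))
  set A : ℕ → ℝ := fun n => ∑ i ∈ Finset.range n, a i with hA
  -- Once δ ≤ ε/2, the excess E - ε/2 shrinks by the factor 1 - a ≤ exp(-a) at each step. The
  -- product of these factors tends to 0 because the sum of the a_n diverges.
  have key : ∀ n, n₀ ≤ n → E n - ε / 2 ≤ Real.exp (-(A n - A n₀)) * E n₀ := by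
    intro n hn
    induction n, hn using Nat.le_induction with
    | base => simp; linarith
    | succ n hn ih =>
      obtain ⟨h0, h1, h2, h3⟩ := h₀ n hn
      have hs : A (n + 1) = A n + a n := Finset.sum_range_succ _ _
      have e1 : E (n + 1) - ε / 2 ≤ (1 - a n) * (E n - ε / 2) := by
        nlinarith [mul_le_mul_of_nonneg_left h3 h0]
      have e2 : (1 - a n) * (E n - ε / 2) ≤ (1 - a n) * (Real.exp (-(A n - A n₀)) * E n₀) :=
        mul_le_mul_of_nonneg_left ih (by linarith)
      have e3 : 1 - a n ≤ Real.exp (-a n) := by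
        have := Real.add_one_le_exp (-a n); linarith
      have e4 : (1 - a n) * (Real.exp (-(A n - A n₀)) * E n₀)
          ≤ Real.exp (-a n) * (Real.exp (-(A n - A n₀)) * E n₀) :=
        mul_le_mul_of_nonneg_right e3 (mul_nonneg (Real.exp_pos _).le (hE _))
      rw [← mul_assoc (Real.exp _), ← Real.exp_add] at e4
      rw [hs]
      calc _ ≤ _ := e1
        _ ≤ _ := e2
        _ ≤ _ := e4
        _ = _ := by congr 2; ring
  have hlim : Tendsto (fun n => Real.exp (-(A n - A n₀)) * E n₀) atTop (𝓝 (0 * E n₀)) := by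
    refine Tendsto.mul_const _ (Real.tendsto_exp_neg_atTop_nhds_zero.comp ?_)
    exact tendsto_atTop_add_const_right _ _ hsum
  rw [zero_mul] at hlim
  obtain ⟨n₁, h₁⟩ := eventually_atTop.1 (hlim.eventually (gt_mem_nhds (half_pos hε)))
  refine ⟨max n₀ n₁, fun n hn => ?_⟩
  have := key n (le_trans (le_max_left _ _) hn)
  have := h₁ n (le_trans (le_max_right _ _) hn)
  rw [Real.dist_eq, sub_zero, abs_of_nonneg (hE n)]
  linarith

/-- The supremum of the deviation is a rate for uniform convergence. The bound is only eventual: a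
real supremum over an unbounded family has default value 0, so early indices may fail. -/
theorem exists_bound_of_tendstoUniformlyOn {ι : Type*} {S : Set ι} {c : ℕ → ι → ℝ} {c' : ι → ℝ}
    (h : TendstoUniformlyOn c c' atTop S) :
    ∃ δ : ℕ → ℝ, Tendsto δ atTop (𝓝 0) ∧ ∀ᶠ n in atTop, ∀ x ∈ S, |c n x - c' x| ≤ δ n := by
  rw [Metric.tendstoUniformlyOn_iff] at h
  simp only [Real.dist_eq] at h
  refine ⟨fun n => ⨆ x : S, |c n x - c' x|, ?_, ?_⟩
  · rw [Metric.tendsto_atTop]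
    intro ε hε
    obtain ⟨n₀, h₀⟩ := eventually_atTop.1 (h (ε / 2) (half_pos hε))
    refine ⟨n₀, fun n hn => ?_⟩
    rw [Real.dist_eq, sub_zero, abs_of_nonneg (Real.iSup_nonneg fun _ => abs_nonneg _)]
    refine lt_of_le_of_lt (Real.iSup_le (fun x => ?_) (half_pos hε).le) (half_lt_self hε)
    rw [abs_sub_comm]
    exact (h₀ n hn x x.2).le
  · filter_upwards [h 1 one_pos] with n hn x hx
    refine le_ciSup (f := fun x : S => |c n x - c' x|) ⟨1, ?_⟩ ⟨x, hx⟩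
    rintro _ ⟨y, rfl⟩
    simp only
    rw [abs_sub_comm]
    exact (hn y y.2).le

theorem tendstoUniformlyOn_of_bound {ι : Type*} {S : Set ι} {c : ℕ → ι → ℝ} {c' : ι → ℝ}
    {δ : ℕ → ℝ} (hδ : Tendsto δ atTop (𝓝 0))
    (h : ∀ᶠ n in atTop, ∀ x ∈ S, |c n x - c' x| ≤ δ n) :
    TendstoUniformlyOn c c' atTop S := by
  rw [Metric.tendstoUniformlyOn_iff]
  intro ε hε
  filter_upwards [h, hδ.eventually (gt_mem_nhds hε)] with n h1 h2 x hx
  rw [dist_comm, Real.dist_eq]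
  exact (h1 x hx).trans_lt h2

/-- The scalar contraction lemma applies to the suprema over S. The hypothesis `hb` makes these
genuine suprema for every n. -/
theorem tendstoUniformlyOn_zero_of_le_contraction {ι : Type*} {S : Set ι} {e : ℕ → ι → ℝ}
    {a δ : ℕ → ℝ} (hb : ∀ n, ∃ B, ∀ x ∈ S, |e n x| ≤ B)
    (ha0 : ∀ᶠ n in atTop, 0 ≤ a n) (ha1 : ∀ᶠ n in atTop, a n ≤ 1)
    (hsum : Tendsto (fun n => ∑ i ∈ Finset.range n, a i) atTop atTop)
    (hδ0 : ∀ᶠ n in atTop, 0 ≤ δ n) (hδ : Tendsto δ atTop (𝓝 0))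
    (hrec : ∀ᶠ n in atTop, ∀ x ∈ S, |e (n + 1) x| ≤ (1 - a n) * |e n x| + a n * δ n) :
    TendstoUniformlyOn e 0 atTop S := by
  have hbdd : ∀ n, BddAbove (Set.range fun x : S => |e n x|) := by
    intro n
    obtain ⟨B, hB⟩ := hb n
    refine ⟨B, ?_⟩
    rintro _ ⟨y, rfl⟩
    exact hB y y.2
  have hE0 : ∀ n, 0 ≤ ⨆ x : S, |e n x| := fun n => Real.iSup_nonneg fun _ => abs_nonneg _
  have hle : ∀ n, ∀ x ∈ S, |e n x| ≤ ⨆ x : S, |e n x| := fun n x hx =>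
    le_ciSup (f := fun x : S => |e n x|) (hbdd n) ⟨x, hx⟩
  refine tendstoUniformlyOn_of_bound (δ := fun n => ⨆ x : S, |e n x|) ?_
    (Eventually.of_forall fun n x hx => by simpa using hle n x hx)
  refine tendsto_zero_of_le_contraction hE0 ha0 ha1 hsum hδ ?_
  filter_upwards [ha0, ha1, hrec, hδ0] with n h0 h1 h2 h3
  have h1' : 0 ≤ 1 - a n := by linarith
  refine Real.iSup_le (fun x => (h2 x x.2).trans ?_)
    (add_nonneg (mul_nonneg h1' (hE0 n)) (mul_nonneg h0 h3))
  gcongr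
  exact hle n x x.2

/-! ### Calculus of the classes `GS`. -/

namespace GS

theorem ratio_tendsto {c : ℝ} {v : ℕ → ℝ} (h : GS c v) :
    Tendsto (fun n : ℕ => v (n - 1) / v n) atTop (𝓝 1) := by
  have h1 : Tendsto (fun n : ℕ => (n : ℝ)⁻¹ * ((n : ℝ) * (1 - v (n - 1) / v n))) atTop
      (𝓝 (0 * c)) := tendsto_inv_atTop_nhds_zero_nat.mul h.2
  have h2 := h1.const_sub 1
  simp only [zero_mul, sub_zero] at h2
  refine h2.congr' ?_
  filter_upwards [eventually_ge_atTop 1] with n hn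
  have : (n : ℝ) ≠ 0 := by positivity
  field_simp
  ring

theorem mul {c d : ℝ} {v w : ℕ → ℝ} (hv : GS c v) (hw : GS d w) :
    GS (c + d) fun n => v n * w n := by
  refine ⟨fun n hn => mul_pos (hv.1 n hn) (hw.1 n hn), ?_⟩
  have h := hv.2.add (hv.ratio_tendsto.mul hw.2)
  rw [one_mul] at h
  refine h.congr' ?_
  filter_upwards [eventually_ge_atTop 1] with n hn
  have := (hv.1 n hn).ne'
  have := (hw.1 n hn).ne'
  field_simp
  ring

theorem rpow {c : ℝ} {v : ℕ → ℝ} (hv : GS c v) (p : ℝ) : GS (p * c) fun n => v n ^ p := by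
  refine ⟨fun n hn => Real.rpow_pos_of_pos (hv.1 n hn) _, ?_⟩
  have hd : HasDerivAt (fun t : ℝ => t ^ p) p 1 := by
    simpa using Real.hasDerivAt_rpow_const (x := 1) (p := p) (Or.inl one_ne_zero)
  -- With r = v_{n-1}/v_n → 1, the quantity n(1 - r^p) is n(1 - r) times the difference quotient of
  -- t^p between r and 1, which tends to p. Using `dslope` covers the case r = 1.
  have hcont : ContinuousAt (dslope (fun t : ℝ => t ^ p) 1) 1 :=
    continuousAt_dslope_same.2 hd.differentiableAt
  have h1 := (hcont.tendsto.comp hv.ratio_tendsto).mul hv.2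
  rw [dslope_same, hd.deriv] at h1
  refine h1.congr' ?_
  filter_upwards [eventually_ge_atTop 2] with n hn
  have h2 := sub_smul_dslope (fun t : ℝ => t ^ p) 1 (v (n - 1) / v n)
  simp only [smul_eq_mul, Real.one_rpow] at h2
  rw [Real.div_rpow (hv.1 _ (by omega)).le (hv.1 n (by omega)).le] at h2
  simp only [Function.comp_apply]
  linear_combination (-(n : ℝ)) * h2

theorem congr {c d : ℝ} {v w : ℕ → ℝ} (hv : GS c v) (hcd : c = d) (h : ∀ n, 1 ≤ n → v n = w n) :
    GS d w := by
  subst hcd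
  refine ⟨fun n hn => h n hn ▸ hv.1 n hn, hv.2.congr' ?_⟩
  filter_upwards [eventually_ge_atTop 2] with n hn
  rw [h n (by omega), h (n - 1) (by omega)]

theorem pow {c : ℝ} {v : ℕ → ℝ} (hv : GS c v) (k : ℕ) : GS (k * c) fun n => v n ^ k :=
  (hv.rpow k).congr rfl fun _ _ => Real.rpow_natCast _ _

theorem inv {c : ℝ} {v : ℕ → ℝ} (hv : GS c v) : GS (-c) fun n => (v n)⁻¹ :=
  (hv.rpow (-1)).congr (by ring) fun _ _ => Real.rpow_neg_one _

theorem sqrt {c : ℝ} {v : ℕ → ℝ} (hv : GS c v) : GS (c / 2) fun n => √(v n) :=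
  (hv.rpow (1 / 2)).congr (by ring) fun _ _ => (Real.sqrt_eq_rpow _).symm

/-- A negative index forces v_{n+1} ≤ (1 - κ/(n+1)) v_n eventually, with κ = -c/2, and the harmonic
series diverges. -/
theorem tendsto_zero {c : ℝ} {v : ℕ → ℝ} (hv : GS c v) (hc : c < 0) :
    Tendsto v atTop (𝓝 0) := by
  -- `v n / v (n-1) = 1 - c_n' / n` with `c_n' → -c > 0`
  have hi : Tendsto (fun n : ℕ => (n : ℝ) * (1 - v n / v (n - 1))) atTop (𝓝 (-c)) := by
    refine hv.inv.2.congr fun n => ?_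
    rw [inv_div_inv]
  have hi' := hi.comp (tendsto_add_atTop_nat 1)
  set κ : ℝ := -c / 2 with hκ
  have hκ0 : 0 < κ := by rw [hκ]; linarith
  have hev : ∀ᶠ n : ℕ in atTop, κ < ((n + 1 : ℕ) : ℝ) * (1 - v (n + 1) / v n) :=
    hi'.eventually (lt_mem_nhds (by rw [hκ]; linarith))
  have hdiv : Tendsto (fun n => ∑ i ∈ Finset.range n, κ / ((i + 1 : ℕ) : ℝ)) atTop atTop := by
    have := Real.tendsto_sum_range_one_div_nat_succ_atTop.const_mul_atTop hκ0
    refine this.congr fun n => ?_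
    rw [Finset.mul_sum]
    refine Finset.sum_congr rfl fun i _ => ?_
    push_cast; ring
  have habs : Tendsto (fun n => |v n|) atTop (𝓝 0) := by
    refine tendsto_zero_of_le_contraction (a := fun i => κ / ((i + 1 : ℕ) : ℝ)) (δ := fun _ => 0)
      (fun n => abs_nonneg _) (Eventually.of_forall fun n => by positivity) ?_ hdiv
      tendsto_const_nhds ?_
    · filter_upwards [(tendsto_natCast_atTop_atTop (R := ℝ)).eventually_ge_atTop κ] with n hn
      rw [div_le_one (by positivity)]
      push_cast; linarith
    · filter_upwards [hev, eventually_ge_atTop 1] with n h1 h2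
      have hv0 := hv.1 n h2
      have hv1 := hv.1 (n + 1) (by omega)
      rw [abs_of_pos hv0, abs_of_pos hv1, mul_zero, add_zero, sub_mul, one_mul]
      have hn : (0 : ℝ) < ((n + 1 : ℕ) : ℝ) := by positivity
      have h3 : κ / ((n + 1 : ℕ) : ℝ) < 1 - v (n + 1) / v n := by
        rw [div_lt_iff₀ hn]; linarith
      have h4 := mul_lt_mul_of_pos_right h3 hv0
      rw [sub_mul, div_mul_cancel₀ _ hv0.ne'] at h4
      linarith
  exact (tendsto_zero_iff_abs_tendsto_zero v).2 habs

theorem tendsto_atTop {c : ℝ} {v : ℕ → ℝ} (hv : GS c v) (hc : 0 < c) :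
    Tendsto v atTop atTop := by
  have h := hv.inv.tendsto_zero (by linarith)
  have h' : Tendsto (fun n => (v n)⁻¹) atTop (𝓝[>] 0) := by
    rw [tendsto_nhdsWithin_iff]
    exact ⟨h, (eventually_ge_atTop 1).mono fun n hn => inv_pos.2 (hv.1 n hn)⟩
  exact h'.inv_tendsto_nhdsGT_zero.congr fun n => inv_inv (v n)

end GS

/-! ### Limits of stochastic-approximation recursions. -/

/-- Dividing by w gives r_{n+1} = (1 - γq) r_n + γc with q → η = s - κξ > 0, so r - c'/η contracts
at rate γq up to an error γ·o(1). Uniformity over S serves the bias; the integrated variance needs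
only the scalar case. -/
theorem tendsto_averaging {ι : Type*} {S : Set ι} {γ w : ℕ → ℝ} {s : ℕ} {κ ξ : ℝ}
    (hγ : ∀ n, 1 ≤ n → 0 < γ n) (hγ0 : Tendsto γ atTop (𝓝 0))
    (hdiv : Tendsto (fun n => ∑ i ∈ Finset.range n, γ (i + 1)) atTop atTop)
    (hξ : Tendsto (fun n : ℕ => ((n : ℝ) * γ n)⁻¹) atTop (𝓝 ξ))
    (hw : GS (-κ) w) (hη : 0 < s - κ * ξ) {u c : ℕ → ι → ℝ} {c' : ι → ℝ}
    (hu : ∀ n, ∀ x ∈ S, u (n + 1) x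
      = (1 - γ (n + 1)) ^ s * u n x + γ (n + 1) * (w (n + 1) * c (n + 1) x))
    (hub : ∀ n, ∃ B, ∀ x ∈ S, |u n x| ≤ B) (hcb : ∃ B, ∀ x ∈ S, |c' x| ≤ B)
    (hc : TendstoUniformlyOn c c' atTop S) :
    TendstoUniformlyOn (fun n x => u n x / w n) (fun x => c' x / (s - κ * ξ)) atTop S := by
  set η : ℝ := s - κ * ξ with hηdef
  set q : ℕ → ℝ := fun n => (1 - (1 - γ n) ^ s * (w (n - 1) / w n)) / γ n with hq
  have hγ0' : Tendsto γ atTop (𝓝[≠] 0) := by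
    rw [tendsto_nhdsWithin_iff]
    exact ⟨hγ0, (eventually_ge_atTop 1).mono fun n hn => (hγ n hn).ne'⟩
  -- Split 1 - (1-γ)^s r as (1 - (1-γ)^s) r + (1 - r), where r = w_{n-1}/w_n. After division by γ
  -- the first part tends to s, the derivative at 0. The second is n(1 - r) times 1/(nγ), which
  -- tends to -κξ.
  have hqlim : Tendsto q atTop (𝓝 η) := by
    have hd : HasDerivAt (fun t : ℝ => 1 - (1 - t) ^ s) s 0 := by
      have h1 := (((hasDerivAt_id (0 : ℝ)).const_sub 1).pow s).const_sub 1
      simpa using h1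
    have h1 := (hasDerivAt_iff_tendsto_slope.1 hd).comp hγ0'
    have h2 := (h1.mul hw.ratio_tendsto).add (hw.2.mul hξ)
    have h3 : (s : ℝ) * 1 + -κ * ξ = η := by rw [hηdef]; ring
    rw [h3] at h2
    refine h2.congr' ?_
    filter_upwards [eventually_ge_atTop 1] with n hn
    have := (hγ n hn).ne'
    have : (n : ℝ) ≠ 0 := by positivity
    simp only [Function.comp_apply, slope_def_field, hq, sub_zero, one_pow, sub_self]
    field_simp
    ring
  have hqlim' := hqlim.comp (tendsto_add_atTop_nat 1)
  have hγ1 := hγ0.comp (tendsto_add_atTop_nat 1)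
  obtain ⟨δ, hδ, hδc⟩ := exists_bound_of_tendstoUniformlyOn hc
  obtain ⟨B, hB⟩ := hcb
  -- The forcing error is divided by q so that γ·q·δ₁ is exactly the error term, as the contraction
  -- lemma requires.
  set δ₁ : ℕ → ℝ := fun n => (|δ (n + 1)| + |B| * |1 - q (n + 1) / η|) / q (n + 1) with hδ₁
  have hqpos : ∀ᶠ n in atTop, η / 2 < q (n + 1) :=
    hqlim'.eventually (lt_mem_nhds (half_lt_self hη))
  have key : TendstoUniformlyOn (fun n x => u n x / w n - c' x / η) 0 atTop S := by
    refine tendstoUniformlyOn_zero_of_le_contraction (a := fun n => γ (n + 1) * q (n + 1))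
      (δ := δ₁) ?_ ?_ ?_ ?_ ?_ ?_ ?_
    · intro n
      obtain ⟨A, hA⟩ := hub n
      refine ⟨A / |w n| + B / η, fun x hx => ?_⟩
      refine (abs_sub _ _).trans ?_
      rw [abs_div, abs_div, abs_of_pos hη]
      gcongr
      · exact hA x hx
      · exact hB x hx
    · filter_upwards [hqpos] with n hn
      exact mul_nonneg (hγ _ (by omega)).le (by linarith)
    · have h1 := hγ1.mul hqlim'
      rw [zero_mul] at h1
      exact (h1.eventually (gt_mem_nhds one_pos)).mono fun n hn => le_of_lt hn
    · obtain ⟨n₀, h₀⟩ := eventually_atTop.1 hqpos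
      have h1 := tendsto_atTop_add_const_right atTop
        (∑ i ∈ Finset.range n₀, (γ (i + 1) * q (i + 1)) - η / 2 * ∑ i ∈ Finset.range n₀, γ (i + 1))
        (hdiv.const_mul_atTop (half_pos hη))
      refine tendsto_atTop_mono' atTop ?_ h1
      filter_upwards [eventually_ge_atTop n₀] with n hn
      induction n, hn using Nat.le_induction with
      | base => simp
      | succ n hn ih =>
        rw [Finset.sum_range_succ, Finset.sum_range_succ]
        have := mul_le_mul_of_nonneg_left (h₀ n hn).le (hγ (n + 1) (by omega)).le
        linarith
    · filter_upwards [hqpos] with n hn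
      have : 0 < q (n + 1) := by linarith
      positivity
    · have h1 := (hδ.comp (tendsto_add_atTop_nat 1)).abs
      have h2 := (((hqlim'.div_const η).const_sub 1).abs.const_mul |B|)
      have h3 := (h1.add h2).div hqlim' hη.ne'
      simp only [div_self hη.ne', sub_self, abs_zero, mul_zero, add_zero, zero_div] at h3
      exact h3
    · filter_upwards [hqpos, (tendsto_add_atTop_nat 1).eventually hδc, eventually_ge_atTop 1,
        (hγ1.mul hqlim').eventually (gt_mem_nhds (by rw [zero_mul]; exact one_pos))]
        with n h1 h2 h3 h4 x hx
      have hq0 : 0 < q (n + 1) := by linarith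
      have hγn := hγ (n + 1) (by omega)
      have hw0 := hw.1 n h3
      have hw1 := hw.1 (n + 1) (by omega)
      have e1 : (1 - γ (n + 1)) ^ s * (w n / w (n + 1)) = 1 - γ (n + 1) * q (n + 1) := by
        simp only [hq, Nat.add_sub_cancel]
        field_simp
        ring
      have e2 : u (n + 1) x / w (n + 1) - c' x / η
          = (1 - γ (n + 1) * q (n + 1)) * (u n x / w n - c' x / η)
            + γ (n + 1) * ((c (n + 1) x - c' x) + c' x * (1 - q (n + 1) / η)) := by
        have e3 : u (n + 1) x / w (n + 1)
          = ((1 - γ (n + 1)) ^ s * (w n / w (n + 1))) * (u n x / w n)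
            + γ (n + 1) * c (n + 1) x := by
          rw [hu n x hx]
          field_simp
        rw [e3, e1]
        field_simp
        ring
      have h4' : γ (n + 1) * q (n + 1) < 1 := h4
      have e4 : γ (n + 1) * q (n + 1) * δ₁ n
          = γ (n + 1) * (|δ (n + 1)| + |B| * |1 - q (n + 1) / η|) := by
        simp only [hδ₁]
        field_simp
      rw [e2, e4]
      refine (abs_add_le _ _).trans ?_
      rw [abs_mul, abs_mul, abs_of_pos hγn, abs_of_nonneg (by linarith : 0 ≤ 1 - γ (n+1) * q (n+1))]
      gcongr
      refine (abs_add_le _ _).trans ?_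
      rw [abs_mul]
      exact add_le_add ((h2 x hx).trans (le_abs_self _))
        (mul_le_mul_of_nonneg_right ((hB x hx).trans (le_abs_self _)) (abs_nonneg _))
  rw [Metric.tendstoUniformlyOn_iff] at key ⊢
  intro ε hε
  filter_upwards [key ε hε] with n hn x hx
  have := hn x hx
  rw [dist_comm, Real.dist_eq] at this ⊢
  simpa using this

/-- Scalar case of `tendsto_averaging`. -/
theorem tendsto_averaging_real {γ w : ℕ → ℝ} {s : ℕ} {κ ξ : ℝ}
    (hγ : ∀ n, 1 ≤ n → 0 < γ n) (hγ0 : Tendsto γ atTop (𝓝 0))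
    (hdiv : Tendsto (fun n => ∑ i ∈ Finset.range n, γ (i + 1)) atTop atTop)
    (hξ : Tendsto (fun n : ℕ => ((n : ℝ) * γ n)⁻¹) atTop (𝓝 ξ))
    (hw : GS (-κ) w) (hη : 0 < s - κ * ξ) {u c : ℕ → ℝ} {c' : ℝ}
    (hu : ∀ n, u (n + 1) = (1 - γ (n + 1)) ^ s * u n + γ (n + 1) * (w (n + 1) * c (n + 1)))
    (hc : Tendsto c atTop (𝓝 c')) :
    Tendsto (fun n => u n / w n) atTop (𝓝 (c' / (s - κ * ξ))) := by
  have h := tendsto_averaging (S := (Set.univ : Set Unit)) (u := fun n _ => u n)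
    (c := fun n _ => c n) (c' := fun _ => c') hγ hγ0 hdiv hξ hw hη (fun n _ _ => hu n)
    (fun n => ⟨|u n|, fun _ _ => le_rfl⟩) ⟨|c'|, fun _ _ => le_rfl⟩ (by
      rw [Metric.tendstoUniformlyOn_iff]
      intro ε hε
      filter_upwards [(Metric.tendsto_nhds.1 hc) ε hε] with n hn _ _
      rwa [dist_comm])
  exact h.tendsto_at (Set.mem_univ ())

/-! ### Integrals of Bernstein polynomials and of their products. -/

theorem bernstein_eval (n k : ℕ) (x : ℝ) :
    (bernsteinPolynomial ℝ n k).eval x = (n.choose k : ℝ) * x ^ k * (1 - x) ^ (n - k) := by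
  simp [bernsteinPolynomial]

theorem bernstein_nonneg (n k : ℕ) {x : ℝ} (hx : x ∈ Set.Icc (0 : ℝ) 1) :
    0 ≤ (bernsteinPolynomial ℝ n k).eval x := by
  rw [bernstein_eval]
  have := hx.1
  have : 0 ≤ 1 - x := by linarith [hx.2]
  positivity

theorem bernstein_sum (n : ℕ) (x : ℝ) :
    ∑ k ∈ Finset.range (n + 1), (bernsteinPolynomial ℝ n k).eval x = 1 := by
  rw [← Polynomial.eval_finsetSum, bernsteinPolynomial.sum, Polynomial.eval_one]

/-- The derivative of b_{k+1}(n+1, ·) is (n+1)(b_k(n, ·) - b_{k+1}(n, ·)), and b_{k+1}(n+1, ·)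
vanishes at both end points because 0 < k+1 < n+1. -/
theorem integral_bernstein_succ {n k : ℕ} (hk : k + 1 ≤ n) :
    ∫ x in (0 : ℝ)..1, (bernsteinPolynomial ℝ n (k + 1)).eval x
      = ∫ x in (0 : ℝ)..1, (bernsteinPolynomial ℝ n k).eval x := by
  have h : ∫ x in (0 : ℝ)..1,
      (Polynomial.derivative (bernsteinPolynomial ℝ (n + 1) (k + 1))).eval x = 0 := by
    rw [intervalIntegral.integral_eq_sub_of_hasDerivAt
      (fun x _ => (bernsteinPolynomial ℝ (n + 1) (k + 1)).hasDerivAt x)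
      ((Polynomial.continuous _).intervalIntegrable _ _),
      bernsteinPolynomial.eval_at_0, bernsteinPolynomial.eval_at_1]
    rw [if_neg (by omega), if_neg (by omega), sub_zero]
  rw [bernsteinPolynomial.derivative_succ] at h
  simp only [Nat.add_sub_cancel, Polynomial.eval_mul, Polynomial.eval_sub] at h
  rw [intervalIntegral.integral_congr (g := fun x => ((n : ℝ) + 1) *
    ((bernsteinPolynomial ℝ n k).eval x - (bernsteinPolynomial ℝ n (k + 1)).eval x))
    (fun x _ => by simp)] at h
  rw [intervalIntegral.integral_const_mul, intervalIntegral.integral_sub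
    ((Polynomial.continuous _).intervalIntegrable _ _)
    ((Polynomial.continuous _).intervalIntegrable _ _)] at h
  have : (n : ℝ) + 1 ≠ 0 := by positivity
  have := (mul_eq_zero.1 h).resolve_left this
  linarith

/-- The n+1 integrals are all equal and the polynomials sum to 1, so no Beta function is needed. -/
theorem integral_bernstein {n k : ℕ} (hk : k ≤ n) :
    ∫ x in (0 : ℝ)..1, (bernsteinPolynomial ℝ n k).eval x = 1 / (n + 1) := by
  have h0 : ∀ j, j ≤ n → ∫ x in (0 : ℝ)..1, (bernsteinPolynomial ℝ n j).eval x
      = ∫ x in (0 : ℝ)..1, (bernsteinPolynomial ℝ n 0).eval x := by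
    intro j
    induction j with
    | zero => intro _; rfl
    | succ j ih => intro hj; rw [integral_bernstein_succ hj, ih (by omega)]
  have h1 : ∑ j ∈ Finset.range (n + 1), ∫ x in (0 : ℝ)..1, (bernsteinPolynomial ℝ n j).eval x
      = 1 := by
    rw [← intervalIntegral.integral_finsetSum
      fun i _ => (Polynomial.continuous _).intervalIntegrable _ _]
    simp [bernstein_sum]
  rw [Finset.sum_congr rfl fun j hj => h0 j (by simpa [Nat.lt_succ_iff] using hj)] at h1
  rw [h0 k hk, eq_div_iff (by positivity)]
  simp only [Finset.sum_const, Finset.card_range, nsmul_eq_mul] at h1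
  push_cast at h1
  linarith

theorem integral_bernstein_mul {n k p j : ℕ} (hk : k ≤ n) (hj : j ≤ p) :
    ∫ x in (0 : ℝ)..1, (bernsteinPolynomial ℝ n k).eval x * (bernsteinPolynomial ℝ p j).eval x
      = (n.choose k : ℝ) * p.choose j / ((n + p + 1) * (n + p).choose (k + j)) := by
  have hc : ((n + p).choose (k + j) : ℝ) ≠ 0 := by
    exact_mod_cast (Nat.choose_pos (by omega)).ne'
  have h : ∀ x : ℝ, (bernsteinPolynomial ℝ n k).eval x * (bernsteinPolynomial ℝ p j).eval x
      = (n.choose k : ℝ) * p.choose j / (n + p).choose (k + j)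
        * (bernsteinPolynomial ℝ (n + p) (k + j)).eval x := by
    intro x
    rw [bernstein_eval, bernstein_eval, bernstein_eval,
      show n + p - (k + j) = (n - k) + (p - j) by omega, pow_add, pow_add]
    field_simp
  simp_rw [h]
  rw [intervalIntegral.integral_const_mul, integral_bernstein (by omega)]
  push_cast
  field_simp

/-! ### Stirling asymptotics of ratios of binomial coefficients. -/

/-- `A_j A_{n-j} / A_n` for the sequence `A_n = choose ((t + 1) n) n`. -/
noncomputable def chooseRatio (t n j : ℕ) : ℝ :=
  (((t + 1) * j).choose j : ℝ) * ((t + 1) * (n - j)).choose (n - j) / ((t + 1) * n).choose n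

theorem chooseRatio_nonneg (t n j : ℕ) : 0 ≤ chooseRatio t n j := by
  unfold chooseRatio; positivity

theorem choose_mul_self_eq (t n : ℕ) :
    (((t + 1) * n).choose n : ℝ) = ((t + 1) * n).factorial / (n.factorial * (t * n).factorial) := by
  have : (t + 1) * n = n + t * n := by ring
  rw [this, Nat.cast_add_choose]

/-- Regrouping the factorials turns a ratio in two indices into a product of values of a one-index
sequence, whose asymptotics then suffice. The case t = 1 serves squares of Bernstein polynomials, t
= 2 products of two degrees in ratio about 2. -/
theorem choose_mul_choose_div_eq_chooseRatio (t : ℕ) {n j : ℕ} (hj : j ≤ n) :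
    ((t * n).choose (t * j) : ℝ) * n.choose j / ((t + 1) * n).choose ((t + 1) * j)
      = chooseRatio t n j := by
  obtain ⟨i, rfl⟩ := Nat.exists_eq_add_of_le hj
  unfold chooseRatio
  rw [choose_mul_self_eq, choose_mul_self_eq, choose_mul_self_eq, Nat.add_sub_cancel_left,
    mul_add t, mul_add (t + 1), Nat.cast_add_choose, Nat.cast_add_choose,
    Nat.cast_add_choose]
  have h := fun k : ℕ => (Nat.cast_ne_zero (R := ℝ)).2 (Nat.factorial_ne_zero k)
  have h1 := h j
  have h2 := h i
  have h3 := h (j + i)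
  have h4 := h (t * j)
  have h5 := h (t * i)
  have h6 := h (t * j + t * i)
  have h7 := h ((t + 1) * j)
  have h8 := h ((t + 1) * i)
  have h9 := h ((t + 1) * j + (t + 1) * i)
  field_simp

/-- Stirling's formula with exponential rate ρ = (t+1)^(t+1)/t^t. The factor √(n+1) in place of √n
keeps the normalised sequence positive at n = 0, so that it and its inverse are bounded over all n.
-/
theorem tendsto_choose_normalised {t : ℕ} (ht : 1 ≤ t) :
    ∃ ρ : ℝ, 0 < ρ ∧ Tendsto (fun n : ℕ => (((t + 1) * n).choose n : ℝ) / ρ ^ n * √(n + 1)) atTop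
      (𝓝 √((t + 1) / (2 * Real.pi * t))) := by
  have ht' : (0 : ℝ) < t := by exact_mod_cast ht
  refine ⟨(t + 1) ^ (t + 1) / t ^ t, by positivity, ?_⟩
  have hS := Stirling.tendsto_stirlingSeq_sqrt_pi
  have hS1 := hS.comp (tendsto_id.const_mul_atTop' (by omega : 0 < t + 1))
  have hS2 := hS.comp (tendsto_id.const_mul_atTop' (by omega : 0 < t))
  have hpi : √Real.pi ≠ 0 := by positivity
  have hr : Tendsto (fun n : ℕ => √(1 + 1 / (n : ℝ))) atTop (𝓝 √(1 + 0)) :=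
    (tendsto_one_div_atTop_nhds_zero_nat.const_add 1).sqrt
  have hlim := ((hS1.div (hS.mul hS2) (mul_ne_zero hpi hpi)).mul_const
    √((t + 1) / (2 * t))).mul hr
  have hval : √Real.pi / (√Real.pi * √Real.pi) * √((t + 1) / (2 * t)) * √(1 + 0)
      = √(((t : ℝ) + 1) / (2 * Real.pi * t)) := by
    rw [add_zero, Real.sqrt_one, mul_one, show ((t : ℝ) + 1) / (2 * Real.pi * t)
      = (t + 1) / (2 * t) / Real.pi by field_simp, Real.sqrt_div' _ Real.pi_pos.le]
    field_simp
  rw [hval] at hlim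
  refine hlim.congr' ?_
  filter_upwards [eventually_ge_atTop 1] with n hn
  have hn' : (0 : ℝ) < n := by exact_mod_cast hn
  have h1 : √(1 + 1 / (n : ℝ)) = √(n + 1) / √n := by
    rw [← Real.sqrt_div' _ hn'.le]; congr 1; field_simp
  have h2 : √(((t : ℝ) + 1) / (2 * t)) = √(t + 1) / (√2 * √t) := by
    rw [Real.sqrt_div (by positivity), Real.sqrt_mul (by positivity)]
  simp only [Function.comp_apply, Stirling.stirlingSeq, id, Pi.div_apply]
  rw [h1, h2, choose_mul_self_eq]
  push_cast
  rw [show (2 : ℝ) * ((t + 1) * n) = 2 * (t + 1) * n by ring,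
    show (2 : ℝ) * (t * n) = 2 * t * n by ring,
    Real.sqrt_mul (by positivity) (n : ℝ), Real.sqrt_mul (by positivity) (n : ℝ),
    Real.sqrt_mul (by positivity) (n : ℝ), Real.sqrt_mul (by positivity) (t : ℝ),
    Real.sqrt_mul (by positivity) ((t : ℝ) + 1)]
  have e1 : ((t + 1 : ℝ) * n / Real.exp 1) ^ ((t + 1) * n)
      = ((t + 1 : ℝ) ^ (t + 1)) ^ n * (n / Real.exp 1) ^ (t * n) * (n / Real.exp 1) ^ n := by
    rw [mul_div_assoc, mul_pow, ← pow_mul, add_mul, one_mul, pow_add (_ / _)]; ring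
  have e2 : ((t : ℝ) * n / Real.exp 1) ^ (t * n)
      = ((t : ℝ) ^ t) ^ n * (n / Real.exp 1) ^ (t * n) := by
    rw [mul_div_assoc, mul_pow, ← pow_mul]
  rw [e1, e2]
  have h := fun k : ℕ => (Nat.cast_ne_zero (R := ℝ)).2 (Nat.factorial_ne_zero k)
  have := h n
  have := h (t * n)
  have : (n : ℝ) / Real.exp 1 ≠ 0 := by positivity
  have h3 : √(n : ℝ) * √n = n := Real.mul_self_sqrt hn'.le
  have h4 : √(2 : ℝ) * √2 = 2 := Real.mul_self_sqrt (by norm_num)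
  have : ((t : ℝ) + 1) ^ (t + 1) ≠ 0 := by positivity
  have : (t : ℝ) ^ t ≠ 0 := by positivity
  generalize (n : ℝ) / Real.exp 1 = z at *
  generalize ((t : ℝ) + 1) ^ (t + 1) = p at *
  generalize (t : ℝ) ^ t = r at *
  rw [div_pow]
  field_simp

theorem exists_bounds_of_tendsto_pos {h : ℕ → ℝ} {c : ℝ} (hpos : ∀ n, 0 < h n) (hc : 0 < c)
    (hlim : Tendsto h atTop (𝓝 c)) : ∃ K, 0 < K ∧ ∀ n, h n ≤ K ∧ (h n)⁻¹ ≤ K := by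
  obtain ⟨A, hA⟩ := hlim.bddAbove_range
  obtain ⟨B, hB⟩ := (hlim.inv₀ hc.ne').bddAbove_range
  have h1 : ∀ n, h n ≤ A := fun n => hA ⟨n, rfl⟩
  have h2 : ∀ n, (h n)⁻¹ ≤ B := fun n => hB ⟨n, rfl⟩
  exact ⟨max A B, lt_max_of_lt_left ((hpos 0).trans_le (h1 0)),
    fun n => ⟨(h1 n).trans (le_max_left _ _), (h2 n).trans (le_max_right _ _)⟩⟩

theorem ceil_pos {M : ℕ} {y : ℝ} (hM : 1 ≤ M) (hy : 0 < y) : 1 ≤ ⌈(M : ℝ) * y⌉₊ := by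
  have : (0 : ℝ) < M := by exact_mod_cast hM
  exact Nat.one_le_ceil_iff.2 (by positivity)

theorem ceil_le {M : ℕ} {y : ℝ} (hy : y ≤ 1) : ⌈(M : ℝ) * y⌉₊ ≤ M := by
  refine Nat.ceil_le.2 ?_
  have : (0 : ℝ) ≤ M := by positivity
  nlinarith

/-- The value of `chooseRatio` in the cell of `y`, on the scale `√M`. -/
noncomputable def cellRatio (t M : ℕ) (y : ℝ) : ℝ := √M * chooseRatio t (M - 1) (⌈(M : ℝ) * y⌉₊ - 1)

theorem cellRatio_nonneg (t M : ℕ) (y : ℝ) : 0 ≤ cellRatio t M y :=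
  mul_nonneg (Real.sqrt_nonneg _) (chooseRatio_nonneg _ _ _)

/-- Exact for every M: the powers of ρ cancel because the two lower indices add up to M - 1. The
same identity gives both the limit and the uniform domination. -/
theorem cellRatio_eq {t : ℕ} {ρ : ℝ} (hρ : 0 < ρ) {h : ℕ → ℝ}
    (hh : ∀ n, h n = (((t + 1) * n).choose n : ℝ) / ρ ^ n * √(n + 1)) {M : ℕ} (hM : 1 ≤ M)
    {y : ℝ} (hy : y ∈ Set.Ioo (0 : ℝ) 1) :
    cellRatio t M y = h (⌈(M : ℝ) * y⌉₊ - 1) * h (M - ⌈(M : ℝ) * y⌉₊) / h (M - 1)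
      / √((⌈(M : ℝ) * y⌉₊ / M) * (1 - ⌈(M : ℝ) * y⌉₊ / M + 1 / M)) := by
  have h1 := ceil_pos hM hy.1
  have h2 := ceil_le (M := M) hy.2.le
  obtain ⟨j, hj⟩ := Nat.exists_eq_add_of_le' h1
  rw [hj] at h2 ⊢
  obtain ⟨i, rfl⟩ := Nat.exists_eq_add_of_le h2
  unfold cellRatio chooseRatio
  rw [hj, show j + 1 + i - 1 = j + i by omega, show j + 1 - 1 = j by omega,
    show j + i - j = i by omega, show j + 1 + i - (j + 1) = i by omega, hh, hh, hh]
  have e : (((j + 1 : ℕ) : ℝ) / ((j + 1 + i : ℕ) : ℝ))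
      * (1 - ((j + 1 : ℕ) : ℝ) / ((j + 1 + i : ℕ) : ℝ) + 1 / ((j + 1 + i : ℕ) : ℝ))
      = ((j : ℝ) + 1) * (i + 1) / ((j + 1 + i : ℕ) : ℝ) ^ 2 := by
    push_cast
    field_simp
    ring
  rw [e, Real.sqrt_div (by positivity), Real.sqrt_sq (by positivity), Real.sqrt_mul (by positivity)]
  have e2 : ((j + i : ℕ) : ℝ) + 1 = ((j + 1 + i : ℕ) : ℝ) := by push_cast; ring
  rw [e2]
  have e3 : ((j + 1 + i : ℕ) : ℝ) = √((j + 1 + i : ℕ) : ℝ) * √((j + 1 + i : ℕ) : ℝ) :=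
    (Real.mul_self_sqrt (by positivity)).symm
  have hz : 0 < √((j + 1 + i : ℕ) : ℝ) := Real.sqrt_pos.2 (by positivity)
  have hc : ∀ n : ℕ, (((t + 1) * n).choose n : ℝ) ≠ 0 := fun n => by
    have := Nat.choose_pos (show n ≤ (t + 1) * n by nlinarith)
    positivity
  have := hc (j + i)
  have := hc j
  have := hc i
  generalize √((j + 1 + i : ℕ) : ℝ) = z at *
  rw [e3]
  have : √((j : ℝ) + 1) ≠ 0 := by positivity
  have : √((i : ℝ) + 1) ≠ 0 := by positivity
  field_simp
  ring

theorem tendsto_ceil_div {y : ℝ} (hy : 0 ≤ y) :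
    Tendsto (fun M : ℕ => (⌈(M : ℝ) * y⌉₊ : ℝ) / M) atTop (𝓝 y) := by
  have := (tendsto_nat_ceil_mul_div_atTop hy).comp (tendsto_natCast_atTop_atTop (R := ℝ))
  refine this.congr fun M => ?_
  simp [mul_comm]

theorem tendsto_ceil_atTop {y : ℝ} (hy : 0 < y) :
    Tendsto (fun M : ℕ => ⌈(M : ℝ) * y⌉₊) atTop atTop :=
  tendsto_nat_ceil_atTop.comp ((tendsto_natCast_atTop_atTop (R := ℝ)).atTop_mul_const hy)

theorem tendsto_sub_ceil_atTop {y : ℝ} (hy0 : 0 ≤ y) (hy : y < 1) :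
    Tendsto (fun M : ℕ => M - ⌈(M : ℝ) * y⌉₊) atTop atTop := by
  have h1 : Tendsto (fun M : ℕ => ⌊(M : ℝ) * (1 - y)⌋₊) atTop atTop :=
    tendsto_nat_floor_atTop.comp
      ((tendsto_natCast_atTop_atTop (R := ℝ)).atTop_mul_const (by linarith))
  refine tendsto_atTop_mono (fun M => ?_) h1
  have hM : (0 : ℝ) ≤ M := by positivity
  have h2 : (⌊(M : ℝ) * (1 - y)⌋₊ : ℝ) ≤ M * (1 - y) :=
    Nat.floor_le (mul_nonneg hM (by linarith))
  have h3 : ⌊(M : ℝ) * (1 - y)⌋₊ ≤ M := by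
    have : (⌊(M : ℝ) * (1 - y)⌋₊ : ℝ) ≤ M := h2.trans (by nlinarith)
    exact_mod_cast this
  have h4 : ⌈(M : ℝ) * y⌉₊ ≤ M - ⌊(M : ℝ) * (1 - y)⌋₊ := by
    refine Nat.ceil_le.2 ?_
    rw [Nat.cast_sub h3]
    linarith
  omega

theorem tendsto_cellRatio {t : ℕ} (ht : 1 ≤ t) {y : ℝ} (hy : y ∈ Set.Ioo (0 : ℝ) 1) :
    Tendsto (fun M => cellRatio t M y) atTop
      (𝓝 (√((t + 1) / (2 * Real.pi * t)) / √(y * (1 - y)))) := by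
  obtain ⟨ρ, hρ, hlim⟩ := tendsto_choose_normalised ht
  set h : ℕ → ℝ := fun n => (((t + 1) * n).choose n : ℝ) / ρ ^ n * √(n + 1) with hh
  set c := √(((t : ℝ) + 1) / (2 * Real.pi * t)) with hc
  have hc0 : c ≠ 0 := by positivity
  have hy' : 0 < y * (1 - y) := mul_pos hy.1 (by linarith [hy.2])
  have l1 := hlim.comp ((tendsto_sub_atTop_nat 1).comp (tendsto_ceil_atTop hy.1))
  have l2 := hlim.comp (tendsto_sub_ceil_atTop hy.1.le hy.2)
  have l3 := hlim.comp (tendsto_sub_atTop_nat 1)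
  have l4 := tendsto_ceil_div hy.1.le
  have l5 := (l4.mul ((l4.const_sub 1).add tendsto_one_div_atTop_nhds_zero_nat)).sqrt
  rw [add_zero] at l5
  have l6 := ((l1.mul l2).div l3 hc0).div l5 (Real.sqrt_pos.2 hy').ne'
  rw [mul_div_cancel_right₀ _ hc0] at l6
  refine l6.congr' ?_
  filter_upwards [eventually_ge_atTop 1] with M hM
  exact (cellRatio_eq hρ (fun n => rfl) hM hy).symm

theorem exists_cellRatio_le {t : ℕ} (ht : 1 ≤ t) :
    ∃ K, 0 ≤ K ∧ ∀ M, 1 ≤ M → ∀ y ∈ Set.Ioo (0 : ℝ) 1, cellRatio t M y ≤ K / √(y * (1 - y)) := by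
  obtain ⟨ρ, hρ, hlim⟩ := tendsto_choose_normalised ht
  set h : ℕ → ℝ := fun n => (((t + 1) * n).choose n : ℝ) / ρ ^ n * √(n + 1) with hh
  have hpos : ∀ n, 0 < h n := fun n => by
    have := Nat.choose_pos (show n ≤ (t + 1) * n by nlinarith)
    simp only [hh]; positivity
  obtain ⟨K, hK0, hK⟩ := exists_bounds_of_tendsto_pos hpos (by positivity) hlim
  refine ⟨K * K * K, by positivity, fun M hM y hy => ?_⟩
  have hM' : (0 : ℝ) < M := by exact_mod_cast hM
  rw [cellRatio_eq hρ (fun n => rfl) hM hy]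
  have hy' : 0 < y * (1 - y) := mul_pos hy.1 (by linarith [hy.2])
  have e1 : y ≤ ⌈(M : ℝ) * y⌉₊ / M := by
    rw [le_div_iff₀ hM', mul_comm]; exact Nat.le_ceil _
  have e2 : 1 - y ≤ 1 - ⌈(M : ℝ) * y⌉₊ / M + 1 / M := by
    have := Nat.ceil_lt_add_one (mul_nonneg hM'.le hy.1.le)
    have : (⌈(M : ℝ) * y⌉₊ : ℝ) / M ≤ (M * y + 1) / M := by gcongr
    rw [add_div, mul_div_cancel_left₀ _ hM'.ne'] at this
    linarith
  refine div_le_div₀ (by positivity) ?_ (Real.sqrt_pos.2 hy') (Real.sqrt_le_sqrt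
    (mul_le_mul e1 e2 (by linarith [hy.2]) (hy.1.le.trans e1)))
  rw [div_eq_mul_inv]
  exact mul_le_mul (mul_le_mul (hK _).1 (hK _).1 (hpos _).le hK0.le) (hK _).2
    (inv_pos.2 (hpos _)).le (by positivity)

/-! ### The kernels `T` and `Z`, and the integral of Z² over x. -/

theorem T_eq {m : ℕ} (hm : 1 ≤ m) {y : ℝ} (hy : y ∈ Set.Ioc (0 : ℝ) 1) (x : ℝ) :
    T m y x = m * (bernsteinPolynomial ℝ (m - 1) (⌈(m : ℝ) * y⌉₊ - 1)).eval x := by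
  have hm' : (0 : ℝ) < m := by exact_mod_cast hm
  have h1 := ceil_pos hm hy.1
  have h2 := ceil_le (M := m) hy.2
  unfold T
  congr 1
  rw [Finset.sum_eq_single_of_mem (⌈(m : ℝ) * y⌉₊ - 1) (Finset.mem_range.2 (by omega))]
  · rw [Set.indicator_of_mem, one_mul]
    have e : ((⌈(m : ℝ) * y⌉₊ - 1 : ℕ) : ℝ) = ⌈(m : ℝ) * y⌉₊ - 1 := by
      rw [Nat.cast_sub h1, Nat.cast_one]
    rw [e, Set.mem_Ioc, div_lt_iff₀ hm', le_div_iff₀ hm']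
    have := Nat.ceil_lt_add_one (mul_nonneg hm'.le hy.1.le)
    have := Nat.le_ceil ((m : ℝ) * y)
    constructor <;> linarith
  · intro k _ hk
    rw [Set.indicator_of_notMem, zero_mul]
    rw [Set.mem_Ioc, div_lt_iff₀ hm', le_div_iff₀ hm']
    rintro ⟨e1, e2⟩
    apply hk
    have : ⌈(m : ℝ) * y⌉₊ = k + 1 := by
      rw [Nat.ceil_eq_iff (by omega)]
      push_cast
      constructor
      · simpa [mul_comm] using e1
      · linarith
    omega

theorem T_nonneg (m : ℕ) (y : ℝ) {x : ℝ} (hx : x ∈ Set.Icc (0 : ℝ) 1) : 0 ≤ T m y x := by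
  unfold T
  refine mul_nonneg (by positivity) (Finset.sum_nonneg fun k _ => mul_nonneg ?_
    (bernstein_nonneg _ _ hx))
  exact Set.indicator_nonneg (fun _ _ => zero_le_one) _

theorem T_le (m : ℕ) (y : ℝ) {x : ℝ} (hx : x ∈ Set.Icc (0 : ℝ) 1) : T m y x ≤ m := by
  rcases Nat.eq_zero_or_pos m with rfl | hm
  · simp [T]
  unfold T
  refine mul_le_of_le_one_right (by positivity) ?_
  obtain ⟨n, rfl⟩ := Nat.exists_eq_add_of_le' hm
  rw [Nat.add_sub_cancel]
  refine le_of_le_of_eq ?_ (bernstein_sum n x)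
  refine Finset.sum_le_sum fun k _ => mul_le_of_le_one_left (bernstein_nonneg _ _ hx) ?_
  exact Set.indicator_le_self' (f := fun _ => (1 : ℝ)) (fun _ _ => zero_le_one) _

theorem abs_Z_le (m : ℕ) (y : ℝ) {x : ℝ} (hx : x ∈ Set.Icc (0 : ℝ) 1) : |Z m y x| ≤ 3 * m := by
  unfold Z
  have h1 := T_nonneg m y hx
  have h2 := T_le m y hx
  have h3 := T_nonneg (m / 2) y hx
  have h4 := T_le (m / 2) y hx
  have h5 : ((m / 2 : ℕ) : ℝ) ≤ m := by exact_mod_cast Nat.div_le_self _ _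
  rw [abs_le]
  constructor <;> linarith

/-- A cell of mesh 1/M splits into two cells of mesh 1/(2M), so the fine index is 2j or 2j+1 when
the coarse one is j. -/
theorem ceil_two_mul {M : ℕ} (hM : 1 ≤ M) {y : ℝ} (hy : 0 < y) :
    ⌈((2 * M : ℕ) : ℝ) * y⌉₊ - 1 = 2 * (⌈(M : ℝ) * y⌉₊ - 1) ∨
      ⌈((2 * M : ℕ) : ℝ) * y⌉₊ - 1 = 2 * (⌈(M : ℝ) * y⌉₊ - 1) + 1 := by
  have hM' : (0 : ℝ) < M := by exact_mod_cast hM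
  have h1 := ceil_pos hM hy
  have h2 := Nat.ceil_lt_add_one (mul_nonneg hM'.le hy.le)
  have h3 := Nat.le_ceil ((M : ℝ) * y)
  have h4 : ⌈((2 * M : ℕ) : ℝ) * y⌉₊ ≤ 2 * ⌈(M : ℝ) * y⌉₊ := by
    refine Nat.ceil_le.2 ?_
    push_cast; linarith
  have h5 : 2 * ⌈(M : ℝ) * y⌉₊ - 2 < ⌈((2 * M : ℕ) : ℝ) * y⌉₊ := by
    refine Nat.lt_ceil.2 ?_
    rw [Nat.cast_sub (by omega)]
    push_cast; linarith
  omega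

/-- Mixed products of Bernstein polynomials of degrees `2 n + 1` and `n` at neighbouring cells. -/
theorem choose_mul_choose_div_eq_mul_chooseRatio {n j k : ℕ} (hj : j ≤ n)
    (hk : k = 2 * j ∨ k = 2 * j + 1) :
    ∃ R : ℝ, |R - 1| ≤ 1 / ((j : ℝ) + 1) + 1 / (((n - j : ℕ) : ℝ) + 1) ∧ 0 ≤ R ∧ R ≤ 1 ∧
      ((2 * n + 1).choose k : ℝ) * n.choose j / (3 * n + 1).choose (k + j)
        = chooseRatio 2 n j * R := by
  obtain ⟨i, rfl⟩ := Nat.exists_eq_add_of_le hj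
  rw [← choose_mul_choose_div_eq_chooseRatio 2 hj, Nat.add_sub_cancel_left]
  have hpos : ∀ a b : ℕ, ((a + b).choose a : ℝ) ≠ 0 := fun a b => by
    exact_mod_cast (Nat.choose_pos (Nat.le_add_right a b)).ne'
  have hb3 : (((2 + 1) * (j + i)).choose ((2 + 1) * j) : ℝ) ≠ 0 := by
    have := hpos ((2 + 1) * j) ((2 + 1) * i); rwa [← mul_add] at this
  have hj0 : (0 : ℝ) ≤ j := by positivity
  have hi0 : (0 : ℝ) ≤ i := by positivity
  -- The degree 2n+1 exceeds 2n by one, so Pascal-type identities reduce both coefficients to the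
  -- aligned ratio. The left and right halves of the cell give formulas for R that exchange j and
  -- n-j.
  rcases hk with rfl | rfl
  · have c1 : ((2 * (j + i) + 1).choose (2 * j) : ℝ)
        = (2 * (j + i)).choose (2 * j) * (2 * (j + i) + 1) / (2 * i + 1) := by
      rw [eq_div_iff (by positivity)]
      have := Nat.choose_mul_succ_eq (2 * (j + i)) (2 * j)
      rw [show 2 * (j + i) + 1 - 2 * j = 2 * i + 1 by omega] at this
      exact_mod_cast this.symm
    have c2 : ((3 * (j + i) + 1).choose (2 * j + j) : ℝ)
        = ((2 + 1) * (j + i)).choose ((2 + 1) * j) * (3 * (j + i) + 1) / (3 * i + 1) := by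
      rw [eq_div_iff (by positivity)]
      have := Nat.choose_mul_succ_eq (3 * (j + i)) (3 * j)
      rw [show 3 * (j + i) + 1 - 3 * j = 3 * i + 1 by omega] at this
      rw [show 2 * j + j = 3 * j by ring]
      exact_mod_cast this.symm
    refine ⟨(2 * (j + i) + 1) * (3 * i + 1) / ((2 * i + 1) * (3 * (j + i) + 1)), ?_, by positivity,
      ?_, ?_⟩
    · have e : ((2 : ℝ) * (j + i) + 1) * (3 * i + 1) / ((2 * i + 1) * (3 * (j + i) + 1)) - 1
          = -(j / ((2 * i + 1) * (3 * (j + i) + 1))) := by field_simp; ring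
      rw [e, abs_neg, abs_of_nonneg (by positivity)]
      refine le_trans ?_ (le_add_of_nonneg_left (by positivity))
      rw [div_le_div_iff₀ (by positivity) (by positivity)]
      nlinarith [mul_nonneg hj0 hi0]
    · rw [div_le_one (by positivity)]; nlinarith [mul_nonneg hj0 hi0]
    · rw [c1, c2]; field_simp
  · have c1 : ((2 * (j + i) + 1).choose (2 * j + 1) : ℝ)
        = (2 * (j + i)).choose (2 * j) * (2 * (j + i) + 1) / (2 * j + 1) := by
      rw [eq_div_iff (by positivity)]
      have := Nat.add_one_mul_choose_eq (2 * (j + i)) (2 * j)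
      have h' : ((2 * (j + i)).choose (2 * j)) * (2 * (j + i) + 1)
        = (2 * (j + i) + 1).choose (2 * j + 1) * (2 * j + 1) := by rw [← this]; ring
      exact_mod_cast h'.symm
    have c2 : ((3 * (j + i) + 1).choose (2 * j + 1 + j) : ℝ)
        = ((2 + 1) * (j + i)).choose ((2 + 1) * j) * (3 * (j + i) + 1) / (3 * j + 1) := by
      rw [eq_div_iff (by positivity)]
      have := Nat.add_one_mul_choose_eq (3 * (j + i)) (3 * j)
      have h' : ((3 * (j + i)).choose (3 * j)) * (3 * (j + i) + 1)
        = (3 * (j + i) + 1).choose (3 * j + 1) * (3 * j + 1) := by rw [← this]; ring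
      rw [show 2 * j + 1 + j = 3 * j + 1 by ring]
      exact_mod_cast h'.symm
    refine ⟨(2 * (j + i) + 1) * (3 * j + 1) / ((2 * j + 1) * (3 * (j + i) + 1)), ?_, by positivity,
      ?_, ?_⟩
    · have e : ((2 : ℝ) * (j + i) + 1) * (3 * j + 1) / ((2 * j + 1) * (3 * (j + i) + 1)) - 1
          = -(i / ((2 * j + 1) * (3 * (j + i) + 1))) := by field_simp; ring
      rw [e, abs_neg, abs_of_nonneg (by positivity)]
      refine le_trans ?_ (le_add_of_nonneg_right (by positivity))
      rw [div_le_div_iff₀ (by positivity) (by positivity)]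
      nlinarith [mul_nonneg hj0 hi0]
    · rw [div_le_one (by positivity)]; nlinarith [mul_nonneg hj0 hi0]
    · rw [c1, c2]; field_simp

/-- The three terms come from the square, with orders 2M and M. The correction R in the cross term
records the misalignment of the degrees 2M-1 and M-1 and tends to 1 for fixed y in (0,1). -/
theorem integral_Z_sq {M : ℕ} (hM : 1 ≤ M) {y : ℝ} (hy : y ∈ Set.Ioo (0 : ℝ) 1) :
    ∃ R : ℝ, |R - 1| ≤ 1 / (((⌈(M : ℝ) * y⌉₊ - 1 : ℕ) : ℝ) + 1)
        + 1 / (((M - ⌈(M : ℝ) * y⌉₊ : ℕ) : ℝ) + 1) ∧ 0 ≤ R ∧ R ≤ 1 ∧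
      (∫ x in (0 : ℝ)..1, Z (2 * M) y x ^ 2) / √((2 * M : ℕ) : ℝ)
        = 4 * (((2 * M : ℕ) : ℝ) / (2 * ((2 * M : ℕ) : ℝ) - 1)) * cellRatio 1 (2 * M) y
          - 4 * √2 * (M / (3 * M - 1)) * (cellRatio 2 M y * R)
          + 1 / √2 * (M / (2 * M - 1)) * cellRatio 1 M y := by
  have hy' : y ∈ Set.Ioc (0 : ℝ) 1 := ⟨hy.1, hy.2.le⟩
  have hc1 := ceil_pos hM hy.1
  have hc2 := ceil_le (M := M) hy.2.le
  have hd1 := ceil_pos (M := 2 * M) (by omega) hy.1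
  have hd2 := ceil_le (M := 2 * M) hy.2.le
  obtain ⟨R, hR, hR0, hR1, hRe⟩ := choose_mul_choose_div_eq_mul_chooseRatio (n := M - 1)
    (j := ⌈(M : ℝ) * y⌉₊ - 1) (by omega) (ceil_two_mul hM hy.1)
  refine ⟨R, ?_, hR0, hR1, ?_⟩
  · rwa [show M - 1 - (⌈(M : ℝ) * y⌉₊ - 1) = M - ⌈(M : ℝ) * y⌉₊ by omega] at hR
  set j := ⌈(M : ℝ) * y⌉₊ - 1 with hj
  set k := ⌈((2 * M : ℕ) : ℝ) * y⌉₊ - 1 with hk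
  set p := fun x => (bernsteinPolynomial ℝ (2 * M - 1) k).eval x with hp
  set q := fun x => (bernsteinPolynomial ℝ (M - 1) j).eval x with hq
  have hZ : ∀ x, Z (2 * M) y x ^ 2
      = 4 * ((2 * M : ℕ) : ℝ) ^ 2 * (p x * p x) - 4 * ((2 * M : ℕ) : ℝ) * M * (p x * q x)
        + (M : ℝ) ^ 2 * (q x * q x) := by
    intro x
    unfold Z
    rw [T_eq (by omega) hy', show 2 * M / 2 = M by omega, T_eq hM hy']
    simp only [hp, hq]
    ring
  have cp : Continuous p := Polynomial.continuous _
  have cq : Continuous q := Polynomial.continuous _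
  simp_rw [hZ]
  rw [intervalIntegral.integral_add (Continuous.intervalIntegrable (by fun_prop) _ _)
      (Continuous.intervalIntegrable (by fun_prop) _ _),
    intervalIntegral.integral_sub (Continuous.intervalIntegrable (by fun_prop) _ _)
      (Continuous.intervalIntegrable (by fun_prop) _ _),
    intervalIntegral.integral_const_mul, intervalIntegral.integral_const_mul,
    intervalIntegral.integral_const_mul]
  simp only [hp, hq]
  rw [integral_bernstein_mul (by omega) (by omega), integral_bernstein_mul (by omega) (by omega),
    integral_bernstein_mul (by omega) (by omega)]
  have hsq : ∀ {n l : ℕ}, l ≤ n → ((n.choose l : ℝ) * n.choose l)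
      / (((n : ℝ) + n + 1) * (n + n).choose (l + l)) = chooseRatio 1 n l / (n + n + 1) := by
    intro n l hl
    rw [← choose_mul_choose_div_eq_chooseRatio 1 hl, one_mul, one_mul,
      show (1 + 1) * n = n + n by ring, show (1 + 1) * l = l + l by ring]
    field_simp
  rw [hsq (by omega), hsq (by omega)]
  rw [show 2 * (M - 1) + 1 = 2 * M - 1 by omega, show 3 * (M - 1) + 1 = 2 * M - 1 + (M - 1) by omega]
    at hRe
  have hcr : (((2 * M - 1).choose k : ℝ) * (M - 1).choose j)
      / ((((2 * M - 1 : ℕ) : ℝ) + ((M - 1 : ℕ) : ℝ) + 1) * ((2 * M - 1) + (M - 1)).choose (k + j))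
      = chooseRatio 2 (M - 1) j * R / (((2 * M - 1 : ℕ) : ℝ) + ((M - 1 : ℕ) : ℝ) + 1) := by
    rw [← hRe]; field_simp
  rw [hcr]
  have hM' : (1 : ℝ) ≤ M := by exact_mod_cast hM
  have hz : 0 < √(M : ℝ) := Real.sqrt_pos.2 (by linarith)
  have e0 : (M : ℝ) = √M * √M := (Real.mul_self_sqrt (by linarith)).symm
  have e2 : √(2 : ℝ) * √2 = 2 := Real.mul_self_sqrt (by norm_num)
  unfold cellRatio
  rw [← hj, ← hk, Nat.cast_sub hM, Nat.cast_sub (by omega : 1 ≤ 2 * M)]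
  push_cast
  rw [Real.sqrt_mul (by norm_num)]
  have d1 : (4 : ℝ) * M - 1 ≠ 0 := by linarith
  have d2 : (3 : ℝ) * M - 1 ≠ 0 := by linarith
  have d3 : (2 : ℝ) * M - 1 ≠ 0 := by linarith
  rw [show (2 : ℝ) * M - 1 + (2 * M - 1) + 1 = 4 * M - 1 by ring,
    show (2 : ℝ) * M - 1 + (M - 1) + 1 = 3 * M - 1 by ring,
    show (M : ℝ) - 1 + (M - 1) + 1 = 2 * M - 1 by ring,
    show (2 : ℝ) * (2 * M) - 1 = 4 * M - 1 by ring]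
  have e3 : √(M : ℝ) ^ 2 = M := Real.sq_sqrt (by linarith)
  have e4 : √(2 : ℝ) ^ 2 = 2 := Real.sq_sqrt (by norm_num)
  field_simp
  simp only [e3, e4]
  ring

theorem ψ_eq {y : ℝ} (hy : y ∈ Set.Ioo (0 : ℝ) 1) :
    ψ y = 1 / (2 * √Real.pi) / √(y * (1 - y)) := by
  have h1 : 0 < y * (1 - y) := mul_pos hy.1 (by linarith [hy.2])
  unfold ψ
  rw [Real.rpow_neg (by rw [mul_assoc]; positivity), ← Real.sqrt_eq_rpow, mul_assoc,
    Real.sqrt_mul (by positivity), Real.sqrt_mul (by positivity),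
    show (4 : ℝ) = 2 ^ 2 by norm_num, Real.sqrt_sq (by norm_num)]
  field_simp

theorem tendsto_integral_Z_sq {y : ℝ} (hy : y ∈ Set.Ioo (0 : ℝ) 1) :
    Tendsto (fun M : ℕ => (∫ x in (0 : ℝ)..1, Z (2 * M) y x ^ 2) / √((2 * M : ℕ) : ℝ)) atTop
      (𝓝 (C₃ * ψ y)) := by
  have hd : Tendsto (fun M : ℕ => 2 * M) atTop atTop := tendsto_id.const_mul_atTop' two_pos
  choose! R hR hR0 hR1 hRe using fun (M : ℕ) (hM : 1 ≤ M) => integral_Z_sq hM hy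
  have hRlim : Tendsto R atTop (𝓝 1) := by
    have h1 := (tendsto_one_div_add_atTop_nhds_zero_nat (𝕜 := ℝ)).comp
      ((tendsto_sub_atTop_nat 1).comp (tendsto_ceil_atTop hy.1))
    have h2 := (tendsto_one_div_add_atTop_nhds_zero_nat (𝕜 := ℝ)).comp
      (tendsto_sub_ceil_atTop hy.1.le hy.2)
    have h3 := h1.add h2
    rw [add_zero] at h3
    have h4 : Tendsto (fun M => R M - 1) atTop (𝓝 0) := by
      refine squeeze_zero_norm' ?_ h3
      filter_upwards [eventually_ge_atTop 1] with M hM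
      exact hR M hM
    simpa using h4.add_const 1
  have hfrac : ∀ c : ℝ, 1 < c → Tendsto (fun M : ℕ => (M : ℝ) / (c * M - 1)) atTop (𝓝 (1 / c)) := by
    intro c hc
    have h1 : Tendsto (fun M : ℕ => 1 / (c - 1 / (M : ℝ))) atTop (𝓝 (1 / (c - 0))) :=
      tendsto_const_nhds.div (tendsto_one_div_atTop_nhds_zero_nat.const_sub c) (by linarith)
    rw [sub_zero] at h1
    refine h1.congr' ?_
    filter_upwards [eventually_ge_atTop 1] with M hM
    have : (1 : ℝ) ≤ M := by exact_mod_cast hM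
    have : c * M - 1 ≠ 0 := by nlinarith
    have : c - 1 / (M : ℝ) ≠ 0 := by
      field_simp; exact div_ne_zero this (by linarith)
    field_simp
  have q1 := tendsto_cellRatio (t := 1) le_rfl hy
  have q2 := tendsto_cellRatio (t := 2) (by norm_num) hy
  have l1 := ((((hfrac 2 (by norm_num)).comp hd).const_mul 4).mul (q1.comp hd))
  have l2 := ((hfrac 3 (by norm_num)).const_mul (4 * √2)).mul (q2.mul hRlim)
  have l3 := ((hfrac 2 (by norm_num)).const_mul (1 / √2)).mul q1
  have l := (l1.sub l2).add l3
  -- In units of ψ(y) the three terms contribute 4, -4√(2/3) and 1/√2, whose sum is C₃.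
  have hval : 4 * (1 / 2) * (√((((1 : ℕ) : ℝ) + 1) / (2 * Real.pi * (1 : ℕ))) / √(y * (1 - y)))
      - 4 * √2 * (1 / 3) * (√((((2 : ℕ) : ℝ) + 1) / (2 * Real.pi * (2 : ℕ))) / √(y * (1 - y)) * 1)
      + 1 / √2 * (1 / 2) * (√((((1 : ℕ) : ℝ) + 1) / (2 * Real.pi * (1 : ℕ))) / √(y * (1 - y)))
      = C₃ * ψ y := by
    have s1 : √((((1 : ℕ) : ℝ) + 1) / (2 * Real.pi * (1 : ℕ))) = 1 / √Real.pi := by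
      rw [show (((1 : ℕ) : ℝ) + 1) / (2 * Real.pi * (1 : ℕ)) = 1 / Real.pi by push_cast; field_simp; norm_num,
        Real.sqrt_div zero_le_one, Real.sqrt_one]
    have s2 : √((((2 : ℕ) : ℝ) + 1) / (2 * Real.pi * (2 : ℕ))) = √3 / (2 * √Real.pi) := by
      rw [show (((2 : ℕ) : ℝ) + 1) / (2 * Real.pi * (2 : ℕ)) = 3 / (2 ^ 2 * Real.pi) by push_cast; field_simp; norm_num,
        Real.sqrt_div (by norm_num), Real.sqrt_mul (by norm_num), Real.sqrt_sq (by norm_num)]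
    have s3 : √(2 / 3 : ℝ) = √2 * √3 / 3 := by
      rw [Real.sqrt_div (by norm_num), div_eq_div_iff (by positivity) (by norm_num), mul_assoc,
        Real.mul_self_sqrt (by norm_num)]
    rw [s1, s2, ψ_eq hy]
    unfold C₃
    rw [s3]
    field_simp
    ring
  rw [hval] at l
  refine l.congr' ?_
  filter_upwards [eventually_ge_atTop 1] with M hM
  rw [hRe M hM]
  rfl

theorem integral_Z_sq_nonneg (m : ℕ) (y : ℝ) : 0 ≤ ∫ x in (0 : ℝ)..1, Z m y x ^ 2 :=
  intervalIntegral.integral_nonneg zero_le_one fun _ _ => sq_nonneg _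

/-- The cross term enters with a negative sign and is dropped; the two squares contribute 4 + 1 = 5
times the bound on `cellRatio 1`. -/
theorem exists_integral_Z_sq_le :
    ∃ K, ∀ M : ℕ, 1 ≤ M → ∀ y ∈ Set.Ioo (0 : ℝ) 1,
      (∫ x in (0 : ℝ)..1, Z (2 * M) y x ^ 2) / √((2 * M : ℕ) : ℝ) ≤ K * ψ y := by
  obtain ⟨K, hK0, hK⟩ := exists_cellRatio_le (t := 1) le_rfl
  refine ⟨5 * K * (2 * √Real.pi), fun M hM y hy => ?_⟩
  obtain ⟨R, -, hR0, hR1, hRe⟩ := integral_Z_sq hM hy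
  rw [hRe, ψ_eq hy]
  have hM' : (1 : ℝ) ≤ M := by exact_mod_cast hM
  have h1 := hK (2 * M) (by omega) y hy
  have h2 := hK M hM y hy
  have h3 : ∀ c : ℝ, 1 ≤ c → c / (2 * c - 1) ≤ 1 := fun c hc => by
    rw [div_le_one (by linarith)]; linarith
  have h3' : ∀ c : ℝ, 1 ≤ c → 0 ≤ c / (2 * c - 1) := fun c hc =>
    div_nonneg (by linarith) (by linarith)
  have hm' : (1 : ℝ) ≤ ((2 * M : ℕ) : ℝ) := by exact_mod_cast (by omega : 1 ≤ 2 * M)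
  have h4 : 0 ≤ 4 * √2 * ((M : ℝ) / (3 * M - 1)) * (cellRatio 2 M y * R) := by
    have := cellRatio_nonneg 2 M y
    have : 0 ≤ (M : ℝ) / (3 * M - 1) := div_nonneg (by linarith) (by linarith)
    positivity
  have h5 : 1 / √(2 : ℝ) ≤ 1 := by
    rw [div_le_one (by positivity)]
    exact Real.one_le_sqrt.2 (by norm_num)
  have e1 : 4 * (((2 * M : ℕ) : ℝ) / (2 * ((2 * M : ℕ) : ℝ) - 1)) * cellRatio 1 (2 * M) y
      ≤ 4 * 1 * (K / √(y * (1 - y))) :=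
    mul_le_mul (mul_le_mul_of_nonneg_left (h3 _ hm') (by norm_num)) h1 (cellRatio_nonneg _ _ _)
      (by norm_num)
  have e2 : 1 / √2 * ((M : ℝ) / (2 * M - 1)) * cellRatio 1 M y ≤ 1 * 1 * (K / √(y * (1 - y))) :=
    mul_le_mul (mul_le_mul h5 (h3 _ hM') (h3' _ hM') zero_le_one) h2 (cellRatio_nonneg _ _ _)
      (by norm_num)
  have e3 : 5 * K * (2 * √Real.pi) * (1 / (2 * √Real.pi) / √(y * (1 - y)))
      = 5 * (K / √(y * (1 - y))) := by field_simp
  rw [e3]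
  linarith

/-! ### Measurability, and dominated convergence in the observation. -/

theorem measurable_T (m : ℕ) : Measurable fun q : ℝ × ℝ => T m q.1 q.2 := by
  unfold T
  refine Measurable.const_mul (Finset.measurable_sum _ fun k _ => Measurable.mul ?_ ?_) _
  · exact ((measurable_const.indicator measurableSet_Ioc).comp measurable_fst)
  · exact (Polynomial.continuous _).measurable.comp measurable_snd

theorem measurable_Z (m : ℕ) : Measurable fun q : ℝ × ℝ => Z m q.1 q.2 :=
  ((measurable_T m).const_mul 2).sub (measurable_T (m / 2))

theorem continuous_T (m : ℕ) (y : ℝ) : Continuous (T m y) := by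
  unfold T
  have := fun k => Polynomial.continuous (bernsteinPolynomial ℝ (m - 1) k)
  fun_prop

theorem continuous_Z (m : ℕ) (y : ℝ) : Continuous (Z m y) :=
  ((continuous_T m y).const_mul 2).sub (continuous_T (m / 2) y)

theorem integrable_ψ : IntervalIntegrable ψ volume 0 1 := by
  have h1 : IntervalIntegrable (fun y : ℝ => y ^ (-(1 / 2) : ℝ)) volume 0 1 :=
    intervalIntegral.intervalIntegrable_rpow' (by norm_num)
  have h2 : IntervalIntegrable (fun y : ℝ => (1 - y) ^ (-(1 / 2) : ℝ)) volume 0 1 := by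
    have := h1.comp_sub_left 1
    simpa using this.symm
  refine (h1.add h2).mono_fun' ?_ ?_
  · have : Measurable ψ := by unfold ψ; fun_prop
    exact this.aestronglyMeasurable
  · have hne : ∀ᵐ y : ℝ ∂(volume.restrict (Set.uIoc (0 : ℝ) 1)), y ≠ 1 :=
      ae_restrict_of_ae (by simp [ae_iff])
    filter_upwards [hne, ae_restrict_mem measurableSet_uIoc] with y hy1 hy
    rw [Set.uIoc_of_le zero_le_one] at hy
    have hy' : y ∈ Set.Ioo (0 : ℝ) 1 := ⟨hy.1, lt_of_le_of_ne hy.2 hy1⟩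
    have hz : 0 < 1 - y := by linarith [hy'.2]
    have hy0 := hy.1
    rw [ψ_eq hy', Real.norm_of_nonneg (by positivity), Real.rpow_neg hy0.le, Real.rpow_neg hz.le,
      ← Real.sqrt_eq_rpow, ← Real.sqrt_eq_rpow]
    have e1 : 1 / (2 * √Real.pi) ≤ 1 := by
      rw [div_le_one (by positivity)]
      have : 1 ≤ √Real.pi := Real.one_le_sqrt.2 (by linarith [Real.pi_gt_three])
      linarith
    -- Since 1/(y(1-y)) = 1/y + 1/(1-y), subadditivity of the square root separates the two
    -- end-point singularities.
    have e2 : (√(y * (1 - y)))⁻¹ = √(y⁻¹ + (1 - y)⁻¹) := by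
      rw [← Real.sqrt_inv]; congr 1; field_simp; ring
    have e3 : √(y⁻¹ + (1 - y)⁻¹) ≤ (√y)⁻¹ + (√(1 - y))⁻¹ := by
      rw [← Real.sqrt_inv, ← Real.sqrt_inv]
      refine Real.sqrt_le_iff.2 ⟨by positivity, ?_⟩
      rw [add_sq, Real.sq_sqrt (by positivity), Real.sq_sqrt (by positivity)]
      have : 0 ≤ 2 * √y⁻¹ * √(1 - y)⁻¹ := by positivity
      linarith
    rw [div_eq_mul_inv, e2]
    exact (mul_le_of_le_one_left (Real.sqrt_nonneg _) e1).trans e3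

theorem tendsto_integral_mul_integral_Z_sq {f : ℝ → ℝ} (hf : ContinuousOn f (Set.Icc 0 1)) :
    Tendsto (fun M : ℕ => ∫ y in (0 : ℝ)..1,
      f y * ((∫ x in (0 : ℝ)..1, Z (2 * M) y x ^ 2) / √((2 * M : ℕ) : ℝ))) atTop
      (𝓝 (C₁ f * C₃)) := by
  obtain ⟨K, hK⟩ := exists_integral_Z_sq_le
  obtain ⟨B, hB⟩ := isCompact_Icc.exists_bound_of_continuousOn hf
  have hval : C₁ f * C₃ = ∫ y in (0 : ℝ)..1, f y * (C₃ * ψ y) := by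
    unfold C₁
    rw [← intervalIntegral.integral_mul_const]
    congr 1; ext y; ring
  rw [hval]
  -- The point y = 1 is removed as a null set: the limit and the bound hold only in the open
  -- interval.
  have hae : ∀ᵐ y : ℝ, y ∈ Set.uIoc (0 : ℝ) 1 → y ∈ Set.Ioo (0 : ℝ) 1 := by
    have : ∀ᵐ y : ℝ, y ≠ 1 := by simp [ae_iff]
    filter_upwards [this] with y hy h
    rw [Set.uIoc_of_le zero_le_one] at h
    exact ⟨h.1, lt_of_le_of_ne h.2 hy⟩
  refine intervalIntegral.tendsto_integral_filter_of_dominated_convergence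
    (fun y => B * (K * ψ y)) ?_ ?_ ((integrable_ψ.const_mul K).const_mul B) ?_
  · refine Eventually.of_forall fun M => AEStronglyMeasurable.mul ?_ ?_
    · rw [Set.uIoc_of_le zero_le_one]
      exact (hf.mono Set.Ioc_subset_Icc_self).aestronglyMeasurable measurableSet_Ioc
    · have h1 : StronglyMeasurable fun y => ∫ x, Z (2 * M) y x ^ 2
          ∂(volume.restrict (Set.Ioc (0 : ℝ) 1)) :=
        ((measurable_Z (2 * M)).pow_const 2).stronglyMeasurable.integral_prod_right
      simp only [intervalIntegral.integral_of_le (zero_le_one' ℝ)]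
      exact (h1.aestronglyMeasurable).mul_const _
  · filter_upwards [eventually_ge_atTop 1] with M hM
    filter_upwards [hae] with y hy hy'
    have h := hy hy'
    rw [norm_mul]
    refine mul_le_mul (hB y ⟨h.1.le, h.2.le⟩) ?_ (norm_nonneg _)
      ((norm_nonneg _).trans (hB y ⟨h.1.le, h.2.le⟩))
    rw [Real.norm_of_nonneg (div_nonneg (integral_Z_sq_nonneg _ _) (Real.sqrt_nonneg _))]
    exact hK M hM y h
  · filter_upwards [hae] with y hy hy'
    exact (tendsto_integral_Z_sq (hy hy')).const_mul _

/-! ### Central moments of the binomial law. -/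

/-- Expectation of `φ` under the binomial law with parameters `n` and `x`. -/
noncomputable def binomialMean (n : ℕ) (x : ℝ) (φ : ℝ → ℝ) : ℝ :=
  ∑ k ∈ Finset.range (n + 1), φ k * (bernsteinPolynomial ℝ n k).eval x

theorem bernstein_succ_succ (n k : ℕ) (x : ℝ) :
    (bernsteinPolynomial ℝ (n + 1) (k + 1)).eval x
      = x * (bernsteinPolynomial ℝ n k).eval x
        + (1 - x) * (bernsteinPolynomial ℝ n (k + 1)).eval x := by
  simp only [bernstein_eval]
  rw [Nat.choose_succ_succ, Nat.add_sub_add_right]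
  rcases lt_or_ge k n with h | h
  · rw [show n - k = n - (k + 1) + 1 by omega]
    push_cast; ring
  · rw [Nat.choose_eq_zero_of_lt (by omega : n < k + 1)]
    push_cast; ring

theorem binomialMean_succ (n : ℕ) (x : ℝ) (φ : ℝ → ℝ) :
    binomialMean (n + 1) x φ
      = x * binomialMean n x (fun s => φ (s + 1)) + (1 - x) * binomialMean n x φ := by
  have h : binomialMean n x φ
      = ∑ k ∈ Finset.range (n + 1 + 1), φ k * (bernsteinPolynomial ℝ n k).eval x := by
    rw [Finset.sum_range_succ _ (n + 1), bernsteinPolynomial.eq_zero_of_lt ℝ (Nat.lt_succ_self n)]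
    simp [binomialMean]
  rw [h, Finset.sum_range_succ', binomialMean, Finset.sum_range_succ', binomialMean,
    mul_add, Finset.mul_sum, Finset.mul_sum, ← add_assoc, ← Finset.sum_add_distrib]
  congr 1
  · refine Finset.sum_congr rfl fun k _ => ?_
    rw [bernstein_succ_succ]
    push_cast; ring
  · simp only [bernstein_eval]
    simp only [Nat.choose_zero_right, pow_zero, Nat.sub_zero]
    push_cast; ring

/-- Central moments of the binomial law. -/
noncomputable def binomialMoment (n : ℕ) (x : ℝ) (i : ℕ) : ℝ :=
  binomialMean n x fun s => (s - n * x) ^ i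

theorem binomialMean_shift (n : ℕ) (x d : ℝ) (i : ℕ) :
    binomialMean n x (fun s => (s - n * x + d) ^ i)
      = ∑ l ∈ Finset.range (i + 1), binomialMoment n x l * (d ^ (i - l) * i.choose l) := by
  simp only [binomialMoment, binomialMean, Finset.sum_mul]
  rw [Finset.sum_comm]
  refine Finset.sum_congr rfl fun k _ => ?_
  rw [add_pow, Finset.sum_mul]
  refine Finset.sum_congr rfl fun l _ => by ring

/-- Conditioning on one trial shifts the centred sum by 1-x with probability x and by -x with
probability 1-x. This recursion in n yields every closed form below by induction. -/
theorem binomialMoment_succ (n : ℕ) (x : ℝ) (i : ℕ) :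
    binomialMoment (n + 1) x i = ∑ l ∈ Finset.range (i + 1), binomialMoment n x l *
      ((x * (1 - x) ^ (i - l) + (1 - x) * (-x) ^ (i - l)) * i.choose l) := by
  rw [binomialMoment, binomialMean_succ]
  have h1 := binomialMean_shift n x (1 - x) i
  have h2 := binomialMean_shift n x (-x) i
  have e1 : (fun s : ℝ => (s + 1 - ((n + 1 : ℕ) : ℝ) * x) ^ i) = fun s => (s - n * x + (1 - x)) ^ i := by
    funext s; push_cast; ring
  have e2 : (fun s : ℝ => (s - ((n + 1 : ℕ) : ℝ) * x) ^ i) = fun s => (s - n * x + (-x)) ^ i := by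
    funext s; push_cast; ring
  rw [e1, e2, h1, h2, Finset.mul_sum, Finset.mul_sum, ← Finset.sum_add_distrib]
  refine Finset.sum_congr rfl fun l _ => by ring

theorem binomialMoment_zero_left (x : ℝ) (i : ℕ) : binomialMoment 0 x i = 0 ^ i := by
  simp [binomialMoment, binomialMean, bernstein_eval]

theorem binomialMoment_zero (n : ℕ) (x : ℝ) : binomialMoment n x 0 = 1 := by
  simp [binomialMoment, binomialMean, bernstein_sum]

theorem binomialMoment_one (n : ℕ) (x : ℝ) : binomialMoment n x 1 = 0 := by
  induction n with
  | zero => simp [binomialMoment_zero_left]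
  | succ n ih =>
    rw [binomialMoment_succ]
    simp [Finset.sum_range_succ, Nat.choose, binomialMoment_zero, ih]
    ring

theorem binomialMoment_two (n : ℕ) (x : ℝ) : binomialMoment n x 2 = n * (x * (1 - x)) := by
  induction n with
  | zero => simp [binomialMoment_zero_left]
  | succ n ih =>
    rw [binomialMoment_succ]
    simp [Finset.sum_range_succ, Nat.choose, binomialMoment_zero, binomialMoment_one, ih]
    ring

theorem binomialMoment_three (n : ℕ) (x : ℝ) :
    binomialMoment n x 3 = n * (x * (1 - x)) * (1 - 2 * x) := by
  induction n with
  | zero => simp [binomialMoment_zero_left]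
  | succ n ih =>
    rw [binomialMoment_succ]
    simp [Finset.sum_range_succ, Nat.choose, binomialMoment_zero, binomialMoment_one,
      binomialMoment_two, ih]
    ring

theorem binomialMoment_four (n : ℕ) (x : ℝ) :
    binomialMoment n x 4 = 3 * n ^ 2 * (x * (1 - x)) ^ 2
      + n * (x * (1 - x)) * (1 - 6 * (x * (1 - x))) := by
  induction n with
  | zero => simp [binomialMoment_zero_left]
  | succ n ih =>
    rw [binomialMoment_succ]
    simp [Finset.sum_range_succ, Nat.choose, binomialMoment_zero, binomialMoment_one,
      binomialMoment_two, binomialMoment_three, ih]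
    ring

theorem binomialMoment_five (n : ℕ) (x : ℝ) :
    binomialMoment n x 5
      = n * (x * (1 - x)) * (1 - 2 * x) * (1 + (10 * n - 12) * (x * (1 - x))) := by
  induction n with
  | zero => simp [binomialMoment_zero_left]
  | succ n ih =>
    rw [binomialMoment_succ]
    simp [Finset.sum_range_succ, Nat.choose, binomialMoment_zero, binomialMoment_one,
      binomialMoment_two, binomialMoment_three, binomialMoment_four, ih]
    ring

theorem binomialMoment_six (n : ℕ) (x : ℝ) :
    binomialMoment n x 6 = n * (x * (1 - x)) * (1 - 30 * (x * (1 - x)) + 120 * (x * (1 - x)) ^ 2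
      + 25 * n * (x * (1 - x)) - 130 * n * (x * (1 - x)) ^ 2 + 15 * n ^ 2 * (x * (1 - x)) ^ 2) := by
  induction n with
  | zero => simp [binomialMoment_zero_left]
  | succ n ih =>
    rw [binomialMoment_succ]
    simp [Finset.sum_range_succ, Nat.choose, binomialMoment_zero, binomialMoment_one,
      binomialMoment_two, binomialMoment_three, binomialMoment_four, binomialMoment_five, ih]
    ring

/-! ### Moments of the kernel `T`. -/

/-- The mean of `T_m(·; x)` against `g` on `[0,1]`. -/
noncomputable def smooth (m : ℕ) (g : ℝ → ℝ) (x : ℝ) : ℝ := ∫ y in (0 : ℝ)..1, T m y x * g y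

theorem smooth_eq_sum {m : ℕ} (hm : 1 ≤ m) {g : ℝ → ℝ} (hg : Continuous g) (x : ℝ) :
    smooth m g x = ∑ k ∈ Finset.range m, (m * ∫ y in ((k : ℝ) / m)..((k + 1 : ℝ) / m), g y)
      * (bernsteinPolynomial ℝ (m - 1) k).eval x := by
  have hm' : (0 : ℝ) < m := by exact_mod_cast hm
  unfold smooth T
  have hi : ∀ k : ℕ, IntervalIntegrable (fun y =>
      (Set.Ioc ((k : ℝ) / m) (((k : ℝ) + 1) / m)).indicator g y) volume 0 1 := fun k => by
    have h := hg.intervalIntegrable (μ := volume) (0 : ℝ) 1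
    rw [intervalIntegrable_iff] at h ⊢
    exact h.indicator measurableSet_Ioc
  have h1 : ∀ y, (m : ℝ) * (∑ k ∈ Finset.range m,
      (Set.Ioc ((k : ℝ) / m) (((k : ℝ) + 1) / m)).indicator (fun _ => (1 : ℝ)) y *
        (bernsteinPolynomial ℝ (m - 1) k).eval x) * g y
      = ∑ k ∈ Finset.range m, (m * (bernsteinPolynomial ℝ (m - 1) k).eval x) *
        (Set.Ioc ((k : ℝ) / m) (((k : ℝ) + 1) / m)).indicator g y := by
    intro y
    rw [mul_assoc, Finset.sum_mul, Finset.mul_sum]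
    refine Finset.sum_congr rfl fun k _ => ?_
    by_cases hy : y ∈ Set.Ioc ((k : ℝ) / m) (((k : ℝ) + 1) / m)
    · rw [Set.indicator_of_mem hy, Set.indicator_of_mem hy]; ring
    · rw [Set.indicator_of_notMem hy, Set.indicator_of_notMem hy]; ring
  simp_rw [h1]
  rw [intervalIntegral.integral_finsetSum fun k _ => (hi k).const_mul _]
  refine Finset.sum_congr rfl fun k hk => ?_
  have hk' : ((k : ℝ) + 1) ≤ m := by exact_mod_cast Finset.mem_range.1 hk
  rw [intervalIntegral.integral_const_mul, intervalIntegral.integral_of_le zero_le_one,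
    setIntegral_indicator measurableSet_Ioc,
    Set.inter_eq_self_of_subset_right (Set.Ioc_subset_Ioc (by positivity)
      ((div_le_one hm').2 hk')), ← intervalIntegral.integral_of_le (by gcongr; linarith)]
  ring

/-- Integrating (y-x)^i over a cell gives a difference of (i+1)-th powers, and (n+1) times the
distances from x to the cell's ends are k - nx + (1-x) and k - nx - x. The top moment l = i+1
cancels in the difference. -/
theorem smooth_pow (n : ℕ) (x : ℝ) (i : ℕ) :
    smooth (n + 1) (fun y => (y - x) ^ i) x = ((n : ℝ) + 1)⁻¹ ^ i * ((i : ℝ) + 1)⁻¹ *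
      ∑ l ∈ Finset.range (i + 1), binomialMoment n x l *
        (((1 - x) ^ (i + 1 - l) - (-x) ^ (i + 1 - l)) * (i + 1).choose l) := by
  rw [smooth_eq_sum (by omega) (by fun_prop)]
  have hn : (n : ℝ) + 1 ≠ 0 := by positivity
  have h1 := binomialMean_shift n x (1 - x) (i + 1)
  have h2 := binomialMean_shift n x (-x) (i + 1)
  have hs : ∑ l ∈ Finset.range (i + 1), binomialMoment n x l *
        (((1 - x) ^ (i + 1 - l) - (-x) ^ (i + 1 - l)) * (i + 1).choose l)
      = binomialMean n x (fun s => (s - n * x + (1 - x)) ^ (i + 1))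
        - binomialMean n x (fun s => (s - n * x + -x) ^ (i + 1)) := by
    rw [h1, h2, ← Finset.sum_sub_distrib, Finset.sum_range_succ _ (i + 1)]
    simp only [Nat.sub_self, pow_zero, sub_self, add_zero]
    refine Finset.sum_congr rfl fun l _ => by ring
  rw [hs, binomialMean, binomialMean, ← Finset.sum_sub_distrib, Finset.mul_sum, Nat.add_sub_cancel]
  refine Finset.sum_congr rfl fun k _ => ?_
  rw [intervalIntegral.integral_comp_sub_right (fun y => y ^ i) x, integral_pow]
  have e1 : ((k : ℝ) + 1) / ((n + 1 : ℕ) : ℝ) - x = ((n : ℝ) + 1)⁻¹ * (k - n * x + (1 - x)) := by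
    push_cast; field_simp; ring
  have e2 : (k : ℝ) / ((n + 1 : ℕ) : ℝ) - x = ((n : ℝ) + 1)⁻¹ * (k - n * x + -x) := by
    push_cast; field_simp; ring
  have hv := mul_inv_cancel₀ hn
  rw [e1, e2, mul_pow, mul_pow, pow_succ ((n : ℝ) + 1)⁻¹]
  push_cast
  generalize ((n : ℝ) + 1)⁻¹ = v at *
  generalize (bernsteinPolynomial ℝ n k).eval x = b
  linear_combination (v ^ i * ((k - n * x + (1 - x)) ^ (i + 1) - (k - n * x + -x) ^ (i + 1))
    / (i + 1) * b) * hv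

theorem smooth_pow_zero {m : ℕ} (hm : 1 ≤ m) (x : ℝ) : smooth m (fun y => (y - x) ^ 0) x = 1 := by
  obtain ⟨n, rfl⟩ := Nat.exists_eq_add_of_le' hm
  rw [smooth_pow]
  simp [binomialMoment_zero]

theorem smooth_pow_one {m : ℕ} (hm : 1 ≤ m) (x : ℝ) :
    smooth m (fun y => (y - x) ^ 1) x = (1 / 2 - x) / m := by
  obtain ⟨n, rfl⟩ := Nat.exists_eq_add_of_le' hm
  rw [smooth_pow]
  simp [Finset.sum_range_succ, Nat.choose, binomialMoment_zero, binomialMoment_one]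
  field_simp
  ring

theorem smooth_pow_two {m : ℕ} (hm : 1 ≤ m) (x : ℝ) :
    smooth m (fun y => (y - x) ^ 2) x
      = (m * (x * (1 - x)) + (1 / 3 - 2 * (x * (1 - x)))) / m ^ 2 := by
  obtain ⟨n, rfl⟩ := Nat.exists_eq_add_of_le' hm
  rw [smooth_pow]
  simp [Finset.sum_range_succ, Nat.choose, binomialMoment_zero, binomialMoment_one,
    binomialMoment_two]
  field_simp
  ring

theorem smooth_pow_three {m : ℕ} (hm : 1 ≤ m) (x : ℝ) :
    smooth m (fun y => (y - x) ^ 3) x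
      = (5 * m * (x * (1 - x)) * (1 / 2 - x) + (1 / 2 - x) * (1 / 2 - 6 * (x * (1 - x))))
        / m ^ 3 := by
  obtain ⟨n, rfl⟩ := Nat.exists_eq_add_of_le' hm
  rw [smooth_pow]
  simp [Finset.sum_range_succ, Nat.choose, binomialMoment_zero, binomialMoment_one,
    binomialMoment_two, binomialMoment_three]
  field_simp
  ring

theorem smooth_pow_four {m : ℕ} (hm : 1 ≤ m) (x : ℝ) :
    smooth m (fun y => (y - x) ^ 4) x
      = (3 * m ^ 2 * (x * (1 - x)) ^ 2 + m * (x * (1 - x)) * (5 - 26 * (x * (1 - x)))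
        + (24 * (x * (1 - x)) ^ 2 - 6 * (x * (1 - x)) + 1 / 5)) / m ^ 4 := by
  obtain ⟨n, rfl⟩ := Nat.exists_eq_add_of_le' hm
  rw [smooth_pow]
  simp [Finset.sum_range_succ, Nat.choose, binomialMoment_zero, binomialMoment_one,
    binomialMoment_two, binomialMoment_three, binomialMoment_four]
  field_simp
  ring

/-- Only the order m⁻³ matters, since it makes the far part of the Taylor remainder negligible after
multiplication by m². The constant 103 is the sum of the crude bounds on the separate terms, using
x(1-x) ≤ 1/4. -/
theorem smooth_pow_six_le {m : ℕ} (hm : 1 ≤ m) {x : ℝ} (hx : x ∈ Set.Icc (0 : ℝ) 1) :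
    smooth m (fun y => (y - x) ^ 6) x ≤ 103 / m ^ 3 := by
  obtain ⟨n, rfl⟩ := Nat.exists_eq_add_of_le' hm
  rw [smooth_pow]
  set q := x * (1 - x) with hq
  have hq0 : 0 ≤ q := mul_nonneg hx.1 (by linarith [hx.2])
  have hq1 : q ≤ 1 / 4 := by nlinarith [sq_nonneg (x - 1 / 2)]
  set N : ℝ := n * q with hN
  have hN0 : 0 ≤ N := by positivity
  have key : ((((6 : ℕ) : ℝ) + 1)⁻¹ * ∑ l ∈ Finset.range (6 + 1), binomialMoment n x l *
        (((1 - x) ^ (6 + 1 - l) - (-x) ^ (6 + 1 - l)) * (6 + 1).choose l))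
      = (N * (1 - 30 * q + 120 * q ^ 2) + 25 * N ^ 2 - 130 * q * N ^ 2 + 15 * N ^ 3)
        + (N * ((3 - 12 * q) * (1 - 12 * q)) + 10 * N ^ 2 * (3 - 12 * q))
        + (5 - 15 * q) * (3 * N ^ 2 + N * (1 - 6 * q))
        + N * ((10 - 40 * q) * (1 / 2 - q)) + N * (3 - 15 * q + 15 * q ^ 2)
        + (1 / 7 - q + 2 * q ^ 2 - q ^ 3) := by
    simp [Finset.sum_range_succ, Nat.choose, binomialMoment_zero, binomialMoment_one,
      binomialMoment_two, binomialMoment_three, binomialMoment_four, binomialMoment_five,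
      binomialMoment_six, hN, hq]
    ring
  rw [mul_assoc, key]
  have hn : (0 : ℝ) ≤ n := by positivity
  have hNn : N ≤ n + 1 := by nlinarith
  have b1 : N * (1 - 30 * q + 120 * q ^ 2) ≤ N * 1 :=
    mul_le_mul_of_nonneg_left (by nlinarith) hN0
  have b2 : 0 ≤ q * N ^ 2 := by positivity
  have b3 : N * ((3 - 12 * q) * (1 - 12 * q)) ≤ N * 3 :=
    mul_le_mul_of_nonneg_left (by nlinarith) hN0
  have b4 : (5 - 15 * q) * (3 * N ^ 2 + N * (1 - 6 * q)) ≤ 15 * N ^ 2 + N * 5 := by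
    have : N * ((5 - 15 * q) * (1 - 6 * q)) ≤ N * 5 :=
      mul_le_mul_of_nonneg_left (by nlinarith) hN0
    nlinarith
  have b5 : N * ((10 - 40 * q) * (1 / 2 - q)) ≤ N * 5 :=
    mul_le_mul_of_nonneg_left (by nlinarith) hN0
  have b6 : N * (3 - 15 * q + 15 * q ^ 2) ≤ N * 3 :=
    mul_le_mul_of_nonneg_left (by nlinarith) hN0
  have b7 : 1 / 7 - q + 2 * q ^ 2 - q ^ 3 ≤ 1 := by
    have : 0 ≤ q ^ 3 := by positivity
    nlinarith
  have h1 : (1 : ℝ) ≤ n + 1 := by linarith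
  have h2 : (n : ℝ) + 1 ≤ (n + 1) ^ 3 := le_self_pow₀ h1 (by norm_num)
  have h3 : ((n : ℝ) + 1) ^ 2 ≤ (n + 1) ^ 3 := pow_le_pow_right₀ h1 (by norm_num)
  have h4 : N ^ 2 ≤ (n + 1) ^ 2 := pow_le_pow_left₀ hN0 hNn 2
  have h5 : N ^ 3 ≤ (n + 1) ^ 3 := pow_le_pow_left₀ hN0 hNn 3
  have tot : (N * (1 - 30 * q + 120 * q ^ 2) + 25 * N ^ 2 - 130 * q * N ^ 2 + 15 * N ^ 3)
        + (N * ((3 - 12 * q) * (1 - 12 * q)) + 10 * N ^ 2 * (3 - 12 * q))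
        + (5 - 15 * q) * (3 * N ^ 2 + N * (1 - 6 * q))
        + N * ((10 - 40 * q) * (1 / 2 - q)) + N * (3 - 15 * q + 15 * q ^ 2)
        + (1 / 7 - q + 2 * q ^ 2 - q ^ 3) ≤ 103 * ((n : ℝ) + 1) ^ 3 := by
    nlinarith
  calc ((n : ℝ) + 1)⁻¹ ^ 6 * _ ≤ ((n : ℝ) + 1)⁻¹ ^ 6 * (103 * ((n : ℝ) + 1) ^ 3) :=
        mul_le_mul_of_nonneg_left tot (by positivity)
    _ = _ := by push_cast; field_simp

/-! ### Taylor's formula with a uniform fourth-order remainder. -/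

theorem D_zero (f : ℝ → ℝ) : D 0 f = f := by
  funext x; simp [D]

theorem continuousOn_D {f : ℝ → ℝ} {n : ℕ} (hf : ContDiffOn ℝ n f (Set.Icc 0 1)) {j : ℕ}
    (hj : j ≤ n) : ContinuousOn (D j f) (Set.Icc 0 1) :=
  hf.continuousOn_iteratedDerivWithin (by exact_mod_cast hj) (uniqueDiffOn_Icc zero_lt_one)

theorem hasDerivWithinAt_D {f : ℝ → ℝ} {n : ℕ} (hf : ContDiffOn ℝ n f (Set.Icc 0 1)) {j : ℕ}
    (hj : j < n) {z : ℝ} (hz : z ∈ Set.Icc (0 : ℝ) 1) :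
    HasDerivWithinAt (D j f) (D (j + 1) f z) (Set.Icc 0 1) z := by
  have h := (hf.differentiableOn_iteratedDerivWithin (m := j) (by exact_mod_cast hj)
    (uniqueDiffOn_Icc zero_lt_one)) z hz
  have h2 := h.hasDerivWithinAt
  unfold D
  rwa [iteratedDerivWithin_succ]

/-- One integration by the mean value inequality on the segment from x to z. The factor 1/(k+1) is
given up, which is harmless for a remainder estimate. -/
theorem abs_le_pow_succ_of_hasDerivWithinAt {g g' : ℝ → ℝ} {x y K : ℝ} {k : ℕ} (hK : 0 ≤ K)
    (hx : x ∈ Set.Icc (0 : ℝ) 1) (hy : y ∈ Set.Icc (0 : ℝ) 1)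
    (hg : ∀ z ∈ Set.Icc (0 : ℝ) 1, HasDerivWithinAt g (g' z) (Set.Icc 0 1) z) (hgx : g x = 0)
    (hb : ∀ z ∈ Set.uIcc x y, |g' z| ≤ K * |z - x| ^ k) :
    ∀ z ∈ Set.uIcc x y, |g z| ≤ K * |z - x| ^ (k + 1) := by
  intro z hz
  have hsub : Set.uIcc x z ⊆ Set.uIcc x y := Set.uIcc_subset_uIcc_left hz
  have hsub' : Set.uIcc x y ⊆ Set.Icc 0 1 := Set.uIcc_subset_Icc hx hy
  have h := Convex.norm_image_sub_le_of_norm_hasDerivWithin_le (s := Set.uIcc x z)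
    (f := g) (f' := g') (C := K * |z - x| ^ k) (x := x) (y := z)
    (fun w hw => (hg w (hsub' (hsub hw))).mono (hsub.trans hsub'))
    (fun w hw => (hb w (hsub hw)).trans (by
      gcongr K * ?_ ^ k
      exact Set.abs_sub_left_of_mem_uIcc hw))
    (convex_uIcc x z) Set.left_mem_uIcc Set.right_mem_uIcc
  rw [hgx, sub_zero, Real.norm_eq_abs, Real.norm_eq_abs] at h
  rwa [pow_succ, ← mul_assoc]

/-- The oscillation of the fourth derivative is integrated four times from x. The remainder must be
controlled on all of [0,1], and the sixth-power term absorbs the points y far from x. -/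
theorem taylor_four_remainder {f : ℝ → ℝ} (hf : ContDiffOn ℝ 4 f (Set.Icc 0 1)) {ε : ℝ}
    (hε : 0 < ε) : ∃ C, 0 ≤ C ∧ ∀ x ∈ Set.Icc (0 : ℝ) 1, ∀ y ∈ Set.Icc (0 : ℝ) 1,
      |f y - (f x + D 1 f x * (y - x) + D 2 f x / 2 * (y - x) ^ 2 + D 3 f x / 6 * (y - x) ^ 3
        + D 4 f x / 24 * (y - x) ^ 4)| ≤ ε * (y - x) ^ 4 + C * (y - x) ^ 6 := by
  have hf' : ContDiffOn ℝ ((4 : ℕ) : WithTop ℕ∞) f (Set.Icc 0 1) := hf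
  have hc := continuousOn_D hf' (le_refl 4)
  have hu := isCompact_Icc.uniformContinuousOn_of_continuous hc
  obtain ⟨B, hB⟩ := isCompact_Icc.exists_bound_of_continuousOn hc
  obtain ⟨δ, hδ, hδu⟩ := Metric.uniformContinuousOn_iff.1 hu ε hε
  have hB0 : 0 ≤ B := (norm_nonneg _).trans (hB 0 (by simp))
  refine ⟨2 * B / δ ^ 2, by positivity, fun x hx y hy => ?_⟩
  set K := ε + 2 * B / δ ^ 2 * (y - x) ^ 2 with hK
  have hK0 : 0 ≤ K := by positivity
  -- Near x, uniform continuity gives ε. Otherwise δ ≤ |z-x| ≤ |y-x|, so the trivial bound 2B is at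
  -- most 2B(y-x)²/δ². Thus K is constant along the segment.
  have h4 : ∀ z ∈ Set.uIcc x y, |D 4 f z - D 4 f x| ≤ K * |z - x| ^ 0 := by
    intro z hz
    have hz' := Set.uIcc_subset_Icc hx hy hz
    rw [pow_zero, mul_one]
    rcases lt_or_ge |z - x| δ with h | h
    · have := hδu z hz' x hx h
      rw [Real.dist_eq] at this
      have : 0 ≤ 2 * B / δ ^ 2 * (y - x) ^ 2 := by positivity
      linarith
    · have h1 : |D 4 f z - D 4 f x| ≤ 2 * B := by
        refine (abs_sub _ _).trans ?_
        have := hB z hz'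
        have := hB x hx
        rw [Real.norm_eq_abs] at *
        linarith
      have h2 : δ ≤ |y - x| := h.trans (Set.abs_sub_left_of_mem_uIcc hz)
      have h3 : δ ^ 2 ≤ (y - x) ^ 2 := by
        rw [← sq_abs (y - x)]; exact pow_le_pow_left₀ hδ.le h2 2
      have h4 : 2 * B ≤ 2 * B / δ ^ 2 * (y - x) ^ 2 := by
        rw [div_mul_eq_mul_div, le_div_iff₀ (by positivity)]
        exact mul_le_mul_of_nonneg_left h3 (by positivity)
      linarith
  have hid : ∀ z : ℝ, HasDerivWithinAt (fun z => z - x) 1 (Set.Icc 0 1) z := fun z =>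
    (hasDerivWithinAt_id z _).sub_const x
  have hpow : ∀ (k : ℕ) (c z : ℝ), HasDerivWithinAt (fun z => c * (z - x) ^ (k + 1))
      (c * ((k + 1) * (z - x) ^ k)) (Set.Icc 0 1) z := fun k c z => by
    have := ((hid z).pow (k + 1)).const_mul c
    refine this.congr_deriv ?_
    push_cast
    simp
  have h3 := abs_le_pow_succ_of_hasDerivWithinAt (g := fun z => D 3 f z - D 3 f x
      - D 4 f x * (z - x) ^ 1) hK0 hx hy
    (fun z hz => (((hasDerivWithinAt_D hf' (by norm_num) hz).sub_const _).sub
      (hpow 0 _ z)).congr_deriv (by push_cast; ring)) (by ring) h4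
  have h2 := abs_le_pow_succ_of_hasDerivWithinAt (g := fun z => D 2 f z - D 2 f x
      - D 3 f x * (z - x) ^ 1 - D 4 f x / 2 * (z - x) ^ 2) hK0 hx hy
    (fun z hz => ((((hasDerivWithinAt_D hf' (by norm_num) hz).sub_const _).sub
      (hpow 0 _ z)).sub (hpow 1 _ z)).congr_deriv (by push_cast; ring)) (by ring) h3
  have h1 := abs_le_pow_succ_of_hasDerivWithinAt (g := fun z => D 1 f z - D 1 f x
      - D 2 f x * (z - x) ^ 1 - D 3 f x / 2 * (z - x) ^ 2 - D 4 f x / 6 * (z - x) ^ 3) hK0 hx hy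
    (fun z hz => (((((hasDerivWithinAt_D hf' (by norm_num) hz).sub_const _).sub
      (hpow 0 _ z)).sub (hpow 1 _ z)).sub (hpow 2 _ z)).congr_deriv (by push_cast; ring))
    (by ring) h2
  have h0 := abs_le_pow_succ_of_hasDerivWithinAt (g := fun z => D 0 f z - D 0 f x
      - D 1 f x * (z - x) ^ 1 - D 2 f x / 2 * (z - x) ^ 2 - D 3 f x / 6 * (z - x) ^ 3
      - D 4 f x / 24 * (z - x) ^ 4) hK0 hx hy
    (fun z hz => ((((((hasDerivWithinAt_D hf' (by norm_num) hz).sub_const _).sub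
      (hpow 0 _ z)).sub (hpow 1 _ z)).sub (hpow 2 _ z)).sub (hpow 3 _ z)).congr_deriv
        (by push_cast; ring))
    (by ring) h1 y Set.right_mem_uIcc
  simp only [D_zero] at h0
  have e1 : |y - x| ^ (0 + 1 + 1 + 1 + 1) = (y - x) ^ 4 := by
    rw [show 0 + 1 + 1 + 1 + 1 = 4 by norm_num]
    exact Even.pow_abs (by decide) _
  rw [e1] at h0
  convert h0 using 1
  · congr 1; ring
  · rw [hK]; ring

/-! ### Uniform bias expansion and its extrapolation. -/

/-- The coefficient of `1/m` in the bias of `T_m`. -/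
noncomputable def biasCoeff (f : ℝ → ℝ) (x : ℝ) : ℝ :=
  D 1 f x * (1 / 2 - x) + D 2 f x / 2 * (x * (1 - x))

theorem continuousOn_Δ₂ {f : ℝ → ℝ} (hf : ContDiffOn ℝ 4 f (Set.Icc 0 1)) :
    ContinuousOn (Δ₂ f) (Set.Icc 0 1) := by
  have hf' : ContDiffOn ℝ ((4 : ℕ) : WithTop ℕ∞) f (Set.Icc 0 1) := hf
  have h2 := continuousOn_D hf' (j := 2) (by norm_num)
  have h3 := continuousOn_D hf' (j := 3) (by norm_num)
  have h4 := continuousOn_D hf' (j := 4) (by norm_num)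
  unfold Δ₂
  fun_prop

theorem intervalIntegrable_T_mul (m : ℕ) {x : ℝ} (hx : x ∈ Set.Icc (0 : ℝ) 1) {g : ℝ → ℝ}
    (hg : ContinuousOn g (Set.Icc 0 1)) :
    IntervalIntegrable (fun y => T m y x * g y) volume 0 1 := by
  have hg' : IntervalIntegrable g volume 0 1 :=
    ContinuousOn.intervalIntegrable (by rwa [Set.uIcc_of_le zero_le_one])
  rw [intervalIntegrable_iff] at hg' ⊢
  refine hg'.bdd_mul (c := m) ?_ ?_
  · exact ((measurable_T m).comp (measurable_id.prodMk measurable_const)).aestronglyMeasurable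
  · refine Eventually.of_forall fun y => ?_
    rw [Real.norm_of_nonneg (T_nonneg m y hx)]
    exact T_le m y hx

theorem smooth_pow_four_le {m : ℕ} (hm : 1 ≤ m) {x : ℝ} (hx : x ∈ Set.Icc (0 : ℝ) 1) :
    smooth m (fun y => (y - x) ^ 4) x ≤ 10 / m ^ 2 := by
  have hm' : (1 : ℝ) ≤ m := by exact_mod_cast hm
  have hm0 : (0 : ℝ) < m := by linarith
  rw [smooth_pow_four hm x]
  set q := x * (1 - x) with hq
  have hq0 : 0 ≤ q := mul_nonneg hx.1 (by linarith [hx.2])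
  have hq1 : q ≤ 1 / 4 := by nlinarith [sq_nonneg (x - 1 / 2)]
  rw [div_le_div_iff₀ (by positivity) (by positivity)]
  have e1 : 3 * (m : ℝ) ^ 2 * q ^ 2 + m * q * (5 - 26 * q) + (24 * q ^ 2 - 6 * q + 1 / 5)
      ≤ 10 * m ^ 2 := by
    have f1 : q * (5 - 26 * q) ≤ 2 := by nlinarith
    have f2 : (m : ℝ) * (q * (5 - 26 * q)) ≤ m * 2 := mul_le_mul_of_nonneg_left f1 hm0.le
    have f3 : 24 * q ^ 2 - 6 * q + 1 / 5 ≤ 1 := by nlinarith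
    have f4 : (m : ℝ) ^ 2 * q ^ 2 ≤ m ^ 2 * 1 :=
      mul_le_mul_of_nonneg_left (by nlinarith) (by positivity)
    have f5 : (m : ℝ) ≤ m ^ 2 := le_self_pow₀ hm' (by norm_num)
    nlinarith
  calc _ ≤ 10 * (m : ℝ) ^ 2 * m ^ 2 := mul_le_mul_of_nonneg_right e1 (by positivity)
    _ = _ := by ring

theorem abs_quartic_coeff_le {q m : ℝ} (hq0 : 0 ≤ q) (hq1 : q ≤ 1 / 4) (hm : 1 ≤ m) :
    |(q * (5 - 26 * q)) + (24 * q ^ 2 - 6 * q + 1 / 5) * (1 / m)| ≤ 24 := by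
  have g0 : 1 / m ≤ 1 := by rw [div_le_one (by linarith)]; exact hm
  have g1 : 0 ≤ 1 / m := by positivity
  refine (abs_add_le _ _).trans ?_
  have : |q * (5 - 26 * q)| ≤ 10 := by rw [abs_le]; constructor <;> nlinarith
  have k1 : |24 * q ^ 2 - 6 * q + 1 / 5| ≤ 10 := by rw [abs_le]; constructor <;> nlinarith
  rw [abs_mul (24 * q ^ 2 - 6 * q + 1 / 5), abs_of_nonneg g1]
  have : |24 * q ^ 2 - 6 * q + 1 / 5| * (1 / m) ≤ 10 * 1 := mul_le_mul k1 g0 g1 (by norm_num)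
  linarith

set_option maxHeartbeats 800000 in
-- Each Taylor monomial is integrated with its exact kernel moment. Moments 1 and 2 give the 1/m
-- term; moments 2, 3 and 4 give Δ₂/m²; the leftovers are O(m⁻³).
theorem smooth_expansion {f : ℝ → ℝ} (hf : ContDiffOn ℝ 4 f (Set.Icc 0 1)) :
    TendstoUniformlyOn
      (fun (m : ℕ) x => (m : ℝ) ^ 2 * (smooth m f x - f x) - m * biasCoeff f x - Δ₂ f x) 0 atTop
      (Set.Icc 0 1) := by
  have hf' : ContDiffOn ℝ ((4 : ℕ) : WithTop ℕ∞) f (Set.Icc 0 1) := hf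
  obtain ⟨B3, hB3⟩ := isCompact_Icc.exists_bound_of_continuousOn
    (continuousOn_D hf' (j := 3) (by norm_num))
  obtain ⟨B4, hB4⟩ := isCompact_Icc.exists_bound_of_continuousOn
    (continuousOn_D hf' (j := 4) (by norm_num))
  have hB30 : 0 ≤ B3 := (norm_nonneg _).trans (hB3 0 (by simp))
  have hB40 : 0 ≤ B4 := (norm_nonneg _).trans (hB4 0 (by simp))
  rw [Metric.tendstoUniformlyOn_iff]
  intro ε hε
  -- The fourth moment is at most 10/m², so ε/20 contributes ε/2 after multiplication by m².
  obtain ⟨C, hC0, hC⟩ := taylor_four_remainder hf (ε := ε / 20) (by positivity)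
  set A := B3 + B4 + 103 * C with hA
  have hlim : Tendsto (fun m : ℕ => A * (1 / (m : ℝ))) atTop (𝓝 (A * 0)) :=
    tendsto_one_div_atTop_nhds_zero_nat.const_mul A
  rw [mul_zero] at hlim
  filter_upwards [hlim.eventually (gt_mem_nhds (half_pos hε)), eventually_ge_atTop 1] with m hm1 hm
    x hx
  have hm' : (1 : ℝ) ≤ m := by exact_mod_cast hm
  have hm0 : (0 : ℝ) < m := by linarith
  rw [dist_comm, Real.dist_eq]
  simp only [Pi.zero_apply, sub_zero]
  set q := x * (1 - x) with hq
  have hq0 : 0 ≤ q := mul_nonneg hx.1 (by linarith [hx.2])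
  have hq1 : q ≤ 1 / 4 := by nlinarith [sq_nonneg (x - 1 / 2)]
  have hx1 : |1 / 2 - x| ≤ 1 / 2 := by rw [abs_le]; constructor <;> linarith [hx.1, hx.2]
  set R : ℝ → ℝ := fun y => f y - (f x + D 1 f x * (y - x) + D 2 f x / 2 * (y - x) ^ 2
    + D 3 f x / 6 * (y - x) ^ 3 + D 4 f x / 24 * (y - x) ^ 4) with hR
  have hRc : ContinuousOn R (Set.Icc 0 1) := by
    have := hf.continuousOn
    simp only [hR]
    fun_prop
  have hi : ∀ i : ℕ, IntervalIntegrable (fun y => T m y x * (y - x) ^ i) volume 0 1 := fun i =>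
    intervalIntegrable_T_mul m hx (by fun_prop)
  have hsum : smooth m f x = f x * smooth m (fun y => (y - x) ^ 0) x
      + D 1 f x * smooth m (fun y => (y - x) ^ 1) x
      + D 2 f x / 2 * smooth m (fun y => (y - x) ^ 2) x
      + D 3 f x / 6 * smooth m (fun y => (y - x) ^ 3) x
      + D 4 f x / 24 * smooth m (fun y => (y - x) ^ 4) x + smooth m R x := by
    unfold smooth
    rw [← intervalIntegral.integral_const_mul, ← intervalIntegral.integral_const_mul,
      ← intervalIntegral.integral_const_mul, ← intervalIntegral.integral_const_mul,
      ← intervalIntegral.integral_const_mul,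
      ← intervalIntegral.integral_add ((hi 0).const_mul _) ((hi 1).const_mul _),
      ← intervalIntegral.integral_add _ ((hi 2).const_mul _),
      ← intervalIntegral.integral_add _ ((hi 3).const_mul _),
      ← intervalIntegral.integral_add _ ((hi 4).const_mul _),
      ← intervalIntegral.integral_add _ (intervalIntegrable_T_mul m hx hRc)]
    · congr 1; ext y; simp only [hR]; ring
    · exact (((((hi 0).const_mul _).add ((hi 1).const_mul _)).add ((hi 2).const_mul _)).add
        ((hi 3).const_mul _)).add ((hi 4).const_mul _)
    · exact ((((hi 0).const_mul _).add ((hi 1).const_mul _)).add ((hi 2).const_mul _)).add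
        ((hi 3).const_mul _)
    · exact (((hi 0).const_mul _).add ((hi 1).const_mul _)).add ((hi 2).const_mul _)
    · exact ((hi 0).const_mul _).add ((hi 1).const_mul _)
  have hRb : |smooth m R x| ≤ ε / 20 * smooth m (fun y => (y - x) ^ 4) x
      + C * smooth m (fun y => (y - x) ^ 6) x := by
    unfold smooth
    refine (intervalIntegral.abs_integral_le_integral_abs zero_le_one).trans ?_
    rw [← intervalIntegral.integral_const_mul, ← intervalIntegral.integral_const_mul,
      ← intervalIntegral.integral_add ((hi 4).const_mul _) ((hi 6).const_mul _)]
    refine intervalIntegral.integral_mono_on zero_le_one (intervalIntegrable_T_mul m hx hRc).abs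
      (((hi 4).const_mul _).add ((hi 6).const_mul _)) fun y hy => ?_
    have hT := T_nonneg m y hx
    rw [abs_mul, abs_of_nonneg hT]
    have := mul_le_mul_of_nonneg_left (hC x hx y hy) hT
    linarith
  have h6 := smooth_pow_six_le hm hx
  rw [smooth_pow_zero hm, smooth_pow_one hm, smooth_pow_two hm, smooth_pow_three hm] at hsum
  have h4 := smooth_pow_four hm x
  have h4b := smooth_pow_four_le hm hx
  have hexp : (m : ℝ) ^ 2 * (smooth m f x - f x) - m * biasCoeff f x - Δ₂ f x
      = D 3 f x / 6 * ((1 / 2 - x) * (1 / 2 - 6 * q)) * (1 / m)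
        + D 4 f x / 24 * ((q * (5 - 26 * q)) + (24 * q ^ 2 - 6 * q + 1 / 5) * (1 / m)) * (1 / m)
        + m ^ 2 * smooth m R x := by
    rw [hsum, h4, biasCoeff, Δ₂]
    simp only [hq]
    field_simp
    ring
  rw [hexp]
  have t1 : |D 3 f x / 6 * ((1 / 2 - x) * (1 / 2 - 6 * q)) * (1 / m)| ≤ B3 * (1 / m) := by
    rw [abs_mul, abs_of_pos (by positivity : (0 : ℝ) < 1 / m)]
    refine mul_le_mul_of_nonneg_right ?_ (by positivity)
    rw [abs_mul, abs_div, abs_mul]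
    have g1 : |D 3 f x| ≤ B3 := hB3 x hx
    have g2 : |1 / 2 - 6 * q| ≤ 1 := by rw [abs_le]; constructor <;> linarith
    have g3 : |1 / 2 - x| * |1 / 2 - 6 * q| ≤ 1 := by
      nlinarith [abs_nonneg (1 / 2 - x), abs_nonneg (1 / 2 - 6 * q)]
    rw [abs_of_pos (by norm_num : (0 : ℝ) < 6)]
    nlinarith [abs_nonneg (D 3 f x), mul_nonneg (abs_nonneg (1 / 2 - x)) (abs_nonneg (1 / 2 - 6 * q))]
  have t2 : |D 4 f x / 24 * ((q * (5 - 26 * q)) + (24 * q ^ 2 - 6 * q + 1 / 5) * (1 / m)) * (1 / m)|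
      ≤ B4 * (1 / m) := by
    rw [abs_mul, abs_of_pos (by positivity : (0 : ℝ) < 1 / m)]
    refine mul_le_mul_of_nonneg_right ?_ (by positivity)
    rw [abs_mul, abs_div, abs_of_pos (by norm_num : (0 : ℝ) < 24)]
    have g1 : |D 4 f x| ≤ B4 := hB4 x hx
    have g2 := abs_quartic_coeff_le hq0 hq1 hm'
    have g3 := mul_le_mul_of_nonneg_left g2 (div_nonneg (abs_nonneg (D 4 f x))
      (by norm_num : (0 : ℝ) ≤ 24))
    refine g3.trans (le_of_eq_of_le ?_ g1)
    ring
  have t3 : |(m : ℝ) ^ 2 * smooth m R x| ≤ ε / 2 + 103 * C * (1 / m) := by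
    rw [abs_mul, abs_of_pos (by positivity : (0 : ℝ) < (m : ℝ) ^ 2)]
    calc (m : ℝ) ^ 2 * |smooth m R x|
        ≤ m ^ 2 * (ε / 20 * (10 / m ^ 2) + C * (103 / m ^ 3)) := by
          refine mul_le_mul_of_nonneg_left (hRb.trans ?_) (by positivity)
          gcongr
      _ = _ := by field_simp; ring
  have t := (abs_add_three _ _ _).trans (add_le_add (add_le_add t1 t2) t3)
  have : A * (1 / (m : ℝ)) = B3 * (1 / m) + B4 * (1 / m) + 103 * C * (1 / m) := by rw [hA]; ring
  linarith

/-- The mean of `Z_m(·; x)` under the density `f`. -/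
noncomputable def meanZ (f : ℝ → ℝ) (m : ℕ) (x : ℝ) : ℝ := ∫ y in (0 : ℝ)..1, Z m y x * f y

/-- The second moment of `Z_m(·; x)` under the density `f`. -/
noncomputable def sqZ (f : ℝ → ℝ) (m : ℕ) (x : ℝ) : ℝ := ∫ y in (0 : ℝ)..1, Z m y x ^ 2 * f y

theorem meanZ_eq {f : ℝ → ℝ} (hf : ContinuousOn f (Set.Icc 0 1)) (m : ℕ) {x : ℝ}
    (hx : x ∈ Set.Icc (0 : ℝ) 1) : meanZ f m x = 2 * smooth m f x - smooth (m / 2) f x := by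
  unfold meanZ smooth Z
  rw [← intervalIntegral.integral_const_mul, ← intervalIntegral.integral_sub
    ((intervalIntegrable_T_mul m hx hf).const_mul 2) (intervalIntegrable_T_mul (m / 2) hx hf)]
  congr 1; ext y; ring

theorem abs_smooth_le {f : ℝ → ℝ} (hf : ContinuousOn f (Set.Icc 0 1)) {B : ℝ}
    (hB : ∀ x ∈ Set.Icc (0 : ℝ) 1, |f x| ≤ B) {m : ℕ} (hm : 1 ≤ m) {x : ℝ}
    (hx : x ∈ Set.Icc (0 : ℝ) 1) : |smooth m f x| ≤ B := by
  have h1 := smooth_pow_zero hm x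
  simp only [pow_zero] at h1
  unfold smooth at h1 ⊢
  refine (intervalIntegral.abs_integral_le_integral_abs zero_le_one).trans ?_
  have h2 : ∫ y in (0 : ℝ)..1, B * (T m y x * 1) = B := by
    rw [intervalIntegral.integral_const_mul, h1, mul_one]
  refine le_of_le_of_eq (intervalIntegral.integral_mono_on zero_le_one
    (intervalIntegrable_T_mul m hx hf).abs
    ((intervalIntegrable_T_mul m hx continuousOn_const).const_mul B) fun y hy => ?_) h2
  have hT := T_nonneg m y hx
  rw [abs_mul, abs_of_nonneg hT, mul_one, mul_comm]
  exact mul_le_mul_of_nonneg_right (hB y hy) hT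

/-- Twice the expansion at 2M minus four times the one at M: the terms in `biasCoeff` cancel and 2 -
4 = -2 multiplies Δ₂. The total error is at most six times each individual one. -/
theorem tendsto_meanZ_bias {f : ℝ → ℝ} (hf : ContDiffOn ℝ 4 f (Set.Icc 0 1)) :
    TendstoUniformlyOn (fun (M : ℕ) x => ((2 * M : ℕ) : ℝ) ^ 2 * (meanZ f (2 * M) x - f x))
      (fun x => -2 * Δ₂ f x) atTop (Set.Icc 0 1) := by
  have h := Metric.tendstoUniformlyOn_iff.1 (smooth_expansion hf)
  have hd : Tendsto (fun M : ℕ => 2 * M) atTop atTop := tendsto_id.const_mul_atTop' two_pos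
  rw [Metric.tendstoUniformlyOn_iff]
  intro ε hε
  have h' := h (ε / 10) (by positivity)
  filter_upwards [h', hd.eventually h'] with M h1 h2 x hx
  have h1 := h1 x hx
  have h2 := h2 x hx
  simp only [Pi.zero_apply, dist_comm (0 : ℝ), Real.dist_eq, sub_zero] at h1 h2
  rw [dist_comm, Real.dist_eq, meanZ_eq hf.continuousOn _ hx, show 2 * M / 2 = M by omega]
  push_cast at h2 ⊢
  rw [abs_lt] at h1 h2 ⊢
  constructor <;> nlinarith

/-! ### Bias-variance decomposition of the MISE. -/

theorem measurable_Z_comp₂ {α : Type*} [MeasurableSpace α] (m : ℕ) {u v : α → ℝ}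
    (hu : Measurable u) (hv : Measurable v) : Measurable fun a => Z m (u a) (v a) := by
  have h : Measurable ((fun q : ℝ × ℝ => Z m q.1 q.2) ∘ fun a => (u a, v a)) :=
    (measurable_Z m).comp (hu.prodMk hv)
  exact h

theorem integral_comp_of_density {Ω : Type*} [MeasurableSpace Ω] {P : Measure Ω} {f : ℝ → ℝ}
    (hf0 : ∀ x ∈ Set.Icc (0 : ℝ) 1, 0 ≤ f x) (hf : ContinuousOn f (Set.Icc 0 1)) {Y : Ω → ℝ}
    (hY : Measurable Y) (hlaw : P.map Y =
      (volume.restrict (Set.Icc (0 : ℝ) 1)).withDensity (fun x => ENNReal.ofReal (f x)))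
    {g : ℝ → ℝ} (hg : Measurable g) :
    ∫ ω, g (Y ω) ∂P = ∫ y in (0 : ℝ)..1, g y * f y := by
  rw [← integral_map hY.aemeasurable hg.aestronglyMeasurable, hlaw,
    integral_withDensity_eq_integral_toReal_smul₀
      (hf.aestronglyMeasurable measurableSet_Icc).aemeasurable.ennreal_ofReal
      (Eventually.of_forall fun _ => ENNReal.ofReal_lt_top),
    intervalIntegral.integral_of_le zero_le_one, ← integral_Icc_eq_integral_Ioc]
  refine setIntegral_congr_fun measurableSet_Icc fun y hy => ?_
  simp only [smul_eq_mul]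
  rw [ENNReal.toReal_ofReal (hf0 y hy), mul_comm]

theorem integral_add_add {α : Type*} [MeasurableSpace α] {μ : Measure α} {u v w : α → ℝ}
    (hu : Integrable u μ) (hv : Integrable v μ) (hw : Integrable w μ) :
    ∫ a, (u a + v a + w a) ∂μ = (∫ a, u a ∂μ) + (∫ a, v a ∂μ) + ∫ a, w a ∂μ := by
  rw [integral_add (f := fun a => u a + v a) (hu.add hv) hw, integral_add hu hv]

theorem integrable_prod_of_bound {Ω : Type*} [MeasurableSpace Ω] {P : Measure Ω}
    [IsProbabilityMeasure P] {g : Ω × ℝ → ℝ}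
    (hg : AEStronglyMeasurable g (P.prod (volume.restrict (Set.Icc (0 : ℝ) 1)))) {B : ℝ}
    (hB : ∀ ω, ∀ x ∈ Set.Icc (0 : ℝ) 1, |g (ω, x)| ≤ B) :
    Integrable g (P.prod (volume.restrict (Set.Icc (0 : ℝ) 1))) := by
  refine Integrable.of_bound hg B ?_
  have := (Measure.quasiMeasurePreserving_snd (μ := P)
    (ν := volume.restrict (Set.Icc (0 : ℝ) 1))).ae (ae_restrict_mem measurableSet_Icc)
  filter_upwards [this] with q hq
  exact hB q.1 q.2 hq

theorem measurable_estimator {Ω : Type*} [MeasurableSpace Ω] (γ : ℕ → ℝ) (N : ℕ → ℕ)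
    {X : ℕ → Ω → ℝ} (hX : ∀ n, 1 ≤ n → Measurable (X n)) (n : ℕ) :
    Measurable fun q : Ω × ℝ => estimator γ N (fun i => X i q.1) n q.2 := by
  induction n with
  | zero => exact measurable_const
  | succ n ih =>
    refine (ih.const_mul _).add (Measurable.const_mul ?_ _)
    exact measurable_Z_comp₂ (N (n + 1)) ((hX (n + 1) (by omega)).comp measurable_fst)
      measurable_snd

theorem exists_estimator_bound (γ : ℕ → ℝ) (N : ℕ → ℕ) (n : ℕ) :
    ∃ B, ∀ y : ℕ → ℝ, ∀ x ∈ Set.Icc (0 : ℝ) 1, |estimator γ N y n x| ≤ B := by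
  induction n with
  | zero => exact ⟨0, fun y x _ => by simp [estimator]⟩
  | succ n ih =>
    obtain ⟨B, hB⟩ := ih
    refine ⟨|1 - γ (n + 1)| * B + |γ (n + 1)| * (3 * N (n + 1)), fun y x hx => ?_⟩
    rw [estimator]
    refine (abs_add_le _ _).trans ?_
    rw [abs_mul, abs_mul]
    gcongr
    · exact hB y x hx
    · exact abs_Z_le _ _ hx

theorem continuousOn_integral_comp_Z_mul {f : ℝ → ℝ} (hf : ContinuousOn f (Set.Icc 0 1)) (m k : ℕ) :
    ContinuousOn (fun x => ∫ y in (0 : ℝ)..1, Z m y x ^ k * f y) (Set.Icc 0 1) := by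
  obtain ⟨B, hB⟩ := isCompact_Icc.exists_bound_of_continuousOn hf
  intro x₀ hx₀
  refine intervalIntegral.continuousWithinAt_of_dominated_interval (bound := fun _ => (3 * m) ^ k * B)
    ?_ ?_ intervalIntegrable_const ?_
  · refine Eventually.of_forall fun x => AEStronglyMeasurable.mul ?_ ?_
    · exact ((measurable_Z_comp₂ m measurable_id measurable_const).pow_const k).aestronglyMeasurable
    · rw [Set.uIoc_of_le zero_le_one]
      exact (hf.mono Set.Ioc_subset_Icc_self).aestronglyMeasurable measurableSet_Ioc
  · filter_upwards [self_mem_nhdsWithin] with x hx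
    refine Eventually.of_forall fun y hy => ?_
    rw [Set.uIoc_of_le zero_le_one] at hy
    rw [norm_mul, norm_pow, Real.norm_eq_abs (Z m y x)]
    exact mul_le_mul (pow_le_pow_left₀ (abs_nonneg _) (abs_Z_le m y hx) k)
      (hB y ⟨hy.1.le, hy.2⟩) (norm_nonneg _) (by positivity)
  · refine Eventually.of_forall fun y _ => ?_
    exact (((continuous_Z m y).pow k).mul continuous_const).continuousWithinAt

theorem continuousOn_meanZ {f : ℝ → ℝ} (hf : ContinuousOn f (Set.Icc 0 1)) (m : ℕ) :
    ContinuousOn (meanZ f m) (Set.Icc 0 1) := by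
  unfold meanZ
  simpa only [pow_one] using continuousOn_integral_comp_Z_mul hf m 1

theorem continuousOn_sqZ {f : ℝ → ℝ} (hf : ContinuousOn f (Set.Icc 0 1)) (m : ℕ) :
    ContinuousOn (sqZ f m) (Set.Icc 0 1) := continuousOn_integral_comp_Z_mul hf m 2

/-- The bias of the recursive estimator. -/
noncomputable def bias (f : ℝ → ℝ) (γ : ℕ → ℝ) (N : ℕ → ℕ) : ℕ → ℝ → ℝ
  | 0, x => -f x
  | n + 1, x => (1 - γ (n + 1)) * bias f γ N n x + γ (n + 1) * (meanZ f (N (n + 1)) x - f x)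

/-- The variance of the recursive estimator. -/
noncomputable def vari (f : ℝ → ℝ) (γ : ℕ → ℝ) (N : ℕ → ℕ) : ℕ → ℝ → ℝ
  | 0, _ => 0
  | n + 1, x => (1 - γ (n + 1)) ^ 2 * vari f γ N n x
      + γ (n + 1) ^ 2 * (sqZ f (N (n + 1)) x - meanZ f (N (n + 1)) x ^ 2)

theorem continuousOn_bias {f : ℝ → ℝ} (hf : ContinuousOn f (Set.Icc 0 1)) (γ : ℕ → ℝ) (N : ℕ → ℕ)
    (n : ℕ) : ContinuousOn (bias f γ N n) (Set.Icc 0 1) := by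
  induction n with
  | zero => exact hf.neg
  | succ n ih =>
    exact (ih.const_mul _).add (((continuousOn_meanZ hf _).sub hf).const_mul _)

theorem continuousOn_vari {f : ℝ → ℝ} (hf : ContinuousOn f (Set.Icc 0 1)) (γ : ℕ → ℝ) (N : ℕ → ℕ)
    (n : ℕ) : ContinuousOn (vari f γ N n) (Set.Icc 0 1) := by
  induction n with
  | zero => exact continuousOn_const
  | succ n ih =>
    exact (ih.const_mul _).add
      (((continuousOn_sqZ hf _).sub ((continuousOn_meanZ hf _).pow 2)).const_mul _)

section Model

variable {Ω : Type*} [MeasurableSpace Ω] {P : Measure Ω} [IsProbabilityMeasure P] {f : ℝ → ℝ}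
  {X : ℕ → Ω → ℝ} {γ : ℕ → ℝ} {N : ℕ → ℕ}

theorem measurable_Z_comp (hX : ∀ n, 1 ≤ n → Measurable (X n)) {k : ℕ} (hk : 1 ≤ k) (m : ℕ)
    (x : ℝ) : Measurable fun ω => Z m (X k ω) x :=
  measurable_Z_comp₂ m (hX k hk) measurable_const

theorem measurable_estimator_apply (hX : ∀ n, 1 ≤ n → Measurable (X n)) (n : ℕ) (x : ℝ) :
    Measurable fun ω => estimator γ N (fun i => X i ω) n x :=
  (measurable_estimator γ N hX n).comp (measurable_id.prodMk measurable_const)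

theorem integrable_Z_comp (hX : ∀ n, 1 ≤ n → Measurable (X n)) {k : ℕ} (hk : 1 ≤ k) (m : ℕ)
    {x : ℝ} (hx : x ∈ Set.Icc (0 : ℝ) 1) : Integrable (fun ω => Z m (X k ω) x) P :=
  Integrable.of_bound (measurable_Z_comp hX hk m x).aestronglyMeasurable (3 * m)
    (Eventually.of_forall fun _ => abs_Z_le m _ hx)

theorem integrable_estimator (hX : ∀ n, 1 ≤ n → Measurable (X n)) (n : ℕ)
    {x : ℝ} (hx : x ∈ Set.Icc (0 : ℝ) 1) :
    Integrable (fun ω => estimator γ N (fun i => X i ω) n x) P := by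
  obtain ⟨B, hB⟩ := exists_estimator_bound γ N n
  exact Integrable.of_bound (measurable_estimator_apply hX n x).aestronglyMeasurable B
    (Eventually.of_forall fun _ => hB _ x hx)

theorem integrable_estimator_mul_Z (hX : ∀ n, 1 ≤ n → Measurable (X n)) (n : ℕ) {k : ℕ}
    (hk : 1 ≤ k) (m : ℕ) {x : ℝ} (hx : x ∈ Set.Icc (0 : ℝ) 1) :
    Integrable (fun ω => estimator γ N (fun i => X i ω) n x * Z m (X k ω) x) P :=
  (integrable_estimator hX n hx).mul_bdd (c := 3 * m)
    (measurable_Z_comp hX hk m x).aestronglyMeasurable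
    (Eventually.of_forall fun _ => abs_Z_le m _ hx)

theorem integrable_estimator_sq (hX : ∀ n, 1 ≤ n → Measurable (X n)) (n : ℕ)
    {x : ℝ} (hx : x ∈ Set.Icc (0 : ℝ) 1) :
    Integrable (fun ω => estimator γ N (fun i => X i ω) n x ^ 2) P := by
  obtain ⟨B, hB⟩ := exists_estimator_bound γ N n
  refine Integrable.of_bound ((measurable_estimator_apply hX n x).pow_const 2).aestronglyMeasurable
    (B ^ 2) (Eventually.of_forall fun ω => ?_)
  rw [norm_pow]
  exact pow_le_pow_left₀ (norm_nonneg _) (hB _ x hx) 2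

/-- The estimator is linear in Z_1, …, Z_n, so pairwise independence of the observations suffices;
induction on n avoids the joint law of the past. -/
theorem integral_estimator_mul_Z (hX : ∀ n, 1 ≤ n → Measurable (X n))
    (hind : iIndepFun (fun n : ℕ => X (n + 1)) P) {x : ℝ} (hx : x ∈ Set.Icc (0 : ℝ) 1)
    (m n k : ℕ) (hnk : n < k) :
    ∫ ω, estimator γ N (fun i => X i ω) n x * Z m (X k ω) x ∂P
      = (∫ ω, estimator γ N (fun i => X i ω) n x ∂P) * ∫ ω, Z m (X k ω) x ∂P := by
  induction n with
  | zero => simp [estimator]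
  | succ n ih =>
    have hi : IndepFun (X (n + 1)) (X k) P := by
      have := hind.indepFun (i := n) (j := k - 1) (by omega)
      rwa [show k - 1 + 1 = k by omega] at this
    have hZ : ∀ m, Measurable fun y => Z m y x := fun m =>
      measurable_Z_comp₂ m measurable_id measurable_const
    have h1 : ∫ ω, Z (N (n + 1)) (X (n + 1) ω) x * Z m (X k ω) x ∂P
        = (∫ ω, Z (N (n + 1)) (X (n + 1) ω) x ∂P) * ∫ ω, Z m (X k ω) x ∂P :=
      hi.integral_fun_comp_mul_comp (f := fun y => Z (N (n + 1)) y x) (g := fun y => Z m y x) (hX _ (by omega)).aemeasurable (hX _ (by omega)).aemeasurable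
        (hZ _).aestronglyMeasurable (hZ _).aestronglyMeasurable
    have e : ∀ ω, estimator γ N (fun i => X i ω) (n + 1) x * Z m (X k ω) x
        = (1 - γ (n + 1)) * (estimator γ N (fun i => X i ω) n x * Z m (X k ω) x)
          + γ (n + 1) * (Z (N (n + 1)) (X (n + 1) ω) x * Z m (X k ω) x) := fun ω => by
      rw [estimator]; ring
    have hZZ : Integrable (fun ω => Z (N (n + 1)) (X (n + 1) ω) x * Z m (X k ω) x) P :=
      (integrable_Z_comp hX (by omega) _ hx).mul_bdd (c := 3 * m)
        (measurable_Z_comp hX (by omega) m x).aestronglyMeasurable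
        (Eventually.of_forall fun _ => abs_Z_le m _ hx)
    simp_rw [e, estimator]
    rw [integral_add ((integrable_estimator_mul_Z hX n (by omega) m hx).const_mul _)
        (hZZ.const_mul _),
      integral_add ((integrable_estimator hX n hx).const_mul _)
        ((integrable_Z_comp hX (by omega) _ hx).const_mul _),
      integral_const_mul, integral_const_mul, integral_const_mul, integral_const_mul,
      ih (by omega), h1]
    ring

/-- The two moments are proved together, since the cross term in the recursion for the second
involves the first. -/
theorem integral_estimator_moments (hf0 : ∀ x ∈ Set.Icc (0 : ℝ) 1, 0 ≤ f x)
    (hf : ContinuousOn f (Set.Icc 0 1)) (hX : ∀ n, 1 ≤ n → Measurable (X n))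
    (hind : iIndepFun (fun n : ℕ => X (n + 1)) P)
    (hlaw : ∀ n, 1 ≤ n → P.map (X n) =
      (volume.restrict (Set.Icc (0 : ℝ) 1)).withDensity (fun x => ENNReal.ofReal (f x)))
    {x : ℝ} (hx : x ∈ Set.Icc (0 : ℝ) 1) (n : ℕ) :
    (∫ ω, estimator γ N (fun i => X i ω) n x ∂P) = bias f γ N n x + f x ∧
      ∫ ω, estimator γ N (fun i => X i ω) n x ^ 2 ∂P
        = vari f γ N n x + (bias f γ N n x + f x) ^ 2 := by
  have hZ : ∀ m, Measurable fun y => Z m y x := fun m =>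
    measurable_Z_comp₂ m measurable_id measurable_const
  induction n with
  | zero => simp [estimator, bias, vari]
  | succ n ih =>
    have m1 : ∫ ω, Z (N (n + 1)) (X (n + 1) ω) x ∂P = meanZ f (N (n + 1)) x :=
      integral_comp_of_density hf0 hf (hX _ (by omega)) (hlaw _ (by omega)) (hZ _)
    have m2 : ∫ ω, Z (N (n + 1)) (X (n + 1) ω) x ^ 2 ∂P = sqZ f (N (n + 1)) x :=
      integral_comp_of_density hf0 hf (hX _ (by omega)) (hlaw _ (by omega)) ((hZ _).pow_const 2)
    have i1 := integrable_estimator (P := P) (γ := γ) (N := N) hX n hx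
    have i2 := integrable_Z_comp (P := P) hX (k := n + 1) (by omega) (N (n + 1)) hx
    have i3 := integrable_estimator_sq (P := P) (γ := γ) (N := N) hX n hx
    have i4 := integrable_estimator_mul_Z (P := P) (γ := γ) (N := N) hX n (k := n + 1) (by omega)
      (N (n + 1)) hx
    have i5 : Integrable (fun ω => Z (N (n + 1)) (X (n + 1) ω) x ^ 2) P := by
      simp only [sq]
      exact i2.mul_bdd (c := 3 * N (n + 1))
        (measurable_Z_comp hX (by omega) _ x).aestronglyMeasurable
        (Eventually.of_forall fun _ => abs_Z_le _ _ hx)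
    constructor
    · simp only [estimator]
      rw [integral_add (i1.const_mul _) (i2.const_mul _), integral_const_mul, integral_const_mul,
        ih.1, m1, bias]
      ring
    · have e : ∀ ω, estimator γ N (fun i => X i ω) (n + 1) x ^ 2
          = (1 - γ (n + 1)) ^ 2 * estimator γ N (fun i => X i ω) n x ^ 2
            + 2 * (1 - γ (n + 1)) * γ (n + 1)
              * (estimator γ N (fun i => X i ω) n x * Z (N (n + 1)) (X (n + 1) ω) x)
            + γ (n + 1) ^ 2 * Z (N (n + 1)) (X (n + 1) ω) x ^ 2 := fun ω => by
        rw [estimator]; ring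
      simp_rw [e]
      rw [integral_add_add (i3.const_mul _) (i4.const_mul _) (i5.const_mul _),
        integral_const_mul, integral_const_mul, integral_const_mul, ih.2, m2,
        integral_estimator_mul_Z hX hind hx _ _ _ (Nat.lt_succ_self n), ih.1, m1, bias, vari]
      ring

theorem integrable_sq_error (hf : ContinuousOn f (Set.Icc 0 1))
    (hX : ∀ n, 1 ≤ n → Measurable (X n)) (n : ℕ) :
    Integrable (fun q : Ω × ℝ => (estimator γ N (fun i => X i q.1) n q.2 - f q.2) ^ 2)
      (P.prod (volume.restrict (Set.Icc (0 : ℝ) 1))) := by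
  obtain ⟨B, hB⟩ := exists_estimator_bound γ N n
  obtain ⟨A, hA⟩ := isCompact_Icc.exists_bound_of_continuousOn hf
  refine integrable_prod_of_bound (B := (B + A) ^ 2) ?_ fun ω x hx => ?_
  · exact ((measurable_estimator γ N hX n).aestronglyMeasurable.sub
      (hf.aestronglyMeasurable measurableSet_Icc).comp_snd).pow 2
  · rw [abs_pow]
    exact pow_le_pow_left₀ (abs_nonneg _)
      ((abs_sub _ _).trans (add_le_add (hB _ x hx) (hA x hx))) 2

theorem MISE_eq (hf0 : ∀ x ∈ Set.Icc (0 : ℝ) 1, 0 ≤ f x)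
    (hf : ContinuousOn f (Set.Icc 0 1)) (hX : ∀ n, 1 ≤ n → Measurable (X n))
    (hind : iIndepFun (fun n : ℕ => X (n + 1)) P)
    (hlaw : ∀ n, 1 ≤ n → P.map (X n) =
      (volume.restrict (Set.Icc (0 : ℝ) 1)).withDensity (fun x => ENNReal.ofReal (f x)))
    (n : ℕ) :
    MISE P f X γ N n
      = (∫ x in (0 : ℝ)..1, bias f γ N n x ^ 2) + ∫ x in (0 : ℝ)..1, vari f γ N n x := by
  have hint := integrable_sq_error (P := P) (γ := γ) (N := N) hf hX n
  have hb : IntegrableOn (fun x => bias f γ N n x ^ 2) (Set.Icc 0 1) volume :=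
    ((continuousOn_bias hf γ N n).pow 2).integrableOn_Icc
  have hv : IntegrableOn (vari f γ N n) (Set.Icc 0 1) volume :=
    (continuousOn_vari hf γ N n).integrableOn_Icc
  unfold MISE
  simp only [intervalIntegral.integral_of_le (zero_le_one' ℝ), ← integral_Icc_eq_integral_Ioc]
  rw [integral_integral_swap (f := fun ω x => (estimator γ N (fun i => X i ω) n x - f x) ^ 2) hint,
    ← integral_add hb hv]
  refine setIntegral_congr_fun measurableSet_Icc fun x hx => ?_
  obtain ⟨h1, h2⟩ := integral_estimator_moments (P := P) (γ := γ) (N := N) hf0 hf hX hind hlaw hx n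
  have i1 := integrable_estimator (P := P) (γ := γ) (N := N) hX n hx
  have i3 := integrable_estimator_sq (P := P) (γ := γ) (N := N) hX n hx
  have e : ∀ ω, (estimator γ N (fun i => X i ω) n x - f x) ^ 2
      = estimator γ N (fun i => X i ω) n x ^ 2 + (-2 * f x) * estimator γ N (fun i => X i ω) n x
        + f x ^ 2 := fun ω => by ring
  simp_rw [e]
  rw [integral_add_add i3 (i1.const_mul _) (integrable_const _),
    integral_const_mul, h1, h2]
  simp
  ring

end Model

/-! ### Integrated variance. -/

/-- The integrated variance of `Z_m`. -/
noncomputable def varZ (f : ℝ → ℝ) (m : ℕ) : ℝ :=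
  ∫ x in (0 : ℝ)..1, (sqZ f m x - meanZ f m x ^ 2)

theorem integral_sqZ {f : ℝ → ℝ} (hf : ContinuousOn f (Set.Icc 0 1)) (m : ℕ) :
    ∫ x in (0 : ℝ)..1, sqZ f m x
      = ∫ y in (0 : ℝ)..1, f y * ∫ x in (0 : ℝ)..1, Z m y x ^ 2 := by
  unfold sqZ
  simp_rw [← intervalIntegral.integral_const_mul]
  simp only [intervalIntegral.integral_of_le (zero_le_one' ℝ), ← integral_Icc_eq_integral_Ioc]
  obtain ⟨A, hA⟩ := isCompact_Icc.exists_bound_of_continuousOn hf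
  have hint : Integrable (fun q : ℝ × ℝ => Z m q.2 q.1 ^ 2 * f q.2)
      ((volume.restrict (Set.Icc (0 : ℝ) 1)).prod (volume.restrict (Set.Icc (0 : ℝ) 1))) := by
    refine Integrable.of_bound (C := (3 * m) ^ 2 * A) ?_ ?_
    · exact (((measurable_Z m).comp measurable_swap).pow_const 2).aestronglyMeasurable.mul
        (hf.aestronglyMeasurable measurableSet_Icc).comp_snd
    · have h1 := (Measure.quasiMeasurePreserving_snd (μ := volume.restrict (Set.Icc (0 : ℝ) 1))
        (ν := volume.restrict (Set.Icc (0 : ℝ) 1))).ae (ae_restrict_mem measurableSet_Icc)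
      have h2 := (Measure.quasiMeasurePreserving_fst (μ := volume.restrict (Set.Icc (0 : ℝ) 1))
        (ν := volume.restrict (Set.Icc (0 : ℝ) 1))).ae (ae_restrict_mem measurableSet_Icc)
      filter_upwards [h1, h2] with q hq1 hq2
      rw [norm_mul, norm_pow]
      exact mul_le_mul (pow_le_pow_left₀ (norm_nonneg _) (abs_Z_le m _ hq2) 2) (hA _ hq1)
        (norm_nonneg _) (by positivity)
  rw [integral_integral_swap (f := fun x y => Z m y x ^ 2 * f y) hint]
  simp only [mul_comm]

/-- The second moment carries the limit. The squared mean stays bounded, by (3B)² with B a bound for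
|f|, and vanishes on the scale √m. -/
theorem tendsto_varZ {f : ℝ → ℝ} (hf : ContinuousOn f (Set.Icc 0 1)) :
    Tendsto (fun M : ℕ => varZ f (2 * M) / √((2 * M : ℕ) : ℝ)) atTop (𝓝 (C₁ f * C₃)) := by
  obtain ⟨B, hB⟩ := isCompact_Icc.exists_bound_of_continuousOn hf
  have hB0 : 0 ≤ B := (norm_nonneg _).trans (hB 0 (by simp))
  have h1 := tendsto_integral_mul_integral_Z_sq hf
  have hd : Tendsto (fun M : ℕ => 2 * M) atTop atTop := tendsto_id.const_mul_atTop' two_pos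
  have hs : Tendsto (fun M : ℕ => √((2 * M : ℕ) : ℝ)) atTop atTop :=
    Real.tendsto_sqrt_atTop.comp (tendsto_natCast_atTop_atTop.comp hd)
  have h2 : Tendsto (fun M : ℕ => (∫ x in (0 : ℝ)..1, meanZ f (2 * M) x ^ 2)
      / √((2 * M : ℕ) : ℝ)) atTop (𝓝 0) := by
    refine squeeze_zero' ?_ ?_ (hs.const_div_atTop ((3 * B) ^ 2))
    · exact Eventually.of_forall fun M => div_nonneg
        (intervalIntegral.integral_nonneg zero_le_one fun _ _ => sq_nonneg _) (Real.sqrt_nonneg _)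
    · filter_upwards [eventually_ge_atTop 1] with M hM
      refine div_le_div_of_nonneg_right ?_ (Real.sqrt_nonneg _)
      have h3 : ∫ _ in (0 : ℝ)..1, (3 * B) ^ 2 = (3 * B) ^ 2 := by simp
      refine le_of_le_of_eq (intervalIntegral.integral_mono_on zero_le_one
        (ContinuousOn.intervalIntegrable ?_) intervalIntegrable_const fun x hx => ?_) h3
      · rw [Set.uIcc_of_le zero_le_one]; exact (continuousOn_meanZ hf _).pow 2
      · rw [← sq_abs]
        refine pow_le_pow_left₀ (abs_nonneg _) ?_ 2
        rw [meanZ_eq hf _ hx]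
        have a1 := abs_smooth_le hf hB (show 1 ≤ 2 * M by omega) hx
        have a2 := abs_smooth_le hf hB (show 1 ≤ 2 * M / 2 by omega) hx
        rw [abs_le] at *
        constructor <;> linarith
  have h := h1.sub h2
  rw [sub_zero] at h
  refine h.congr fun M => ?_
  have hc := continuousOn_meanZ hf (2 * M)
  have hc' := continuousOn_sqZ hf (2 * M)
  have e : ∫ y in (0 : ℝ)..1, f y * ((∫ x in (0 : ℝ)..1, Z (2 * M) y x ^ 2) / √((2 * M : ℕ) : ℝ))
      = (∫ y in (0 : ℝ)..1, f y * ∫ x in (0 : ℝ)..1, Z (2 * M) y x ^ 2) / √((2 * M : ℕ) : ℝ) := by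
    rw [← intervalIntegral.integral_div]
    simp only [mul_div_assoc]
  rw [varZ, intervalIntegral.integral_sub, integral_sqZ hf, sub_div, e]
  · exact ContinuousOn.intervalIntegrable (by rwa [Set.uIcc_of_le zero_le_one])
  · exact ContinuousOn.intervalIntegrable (by rw [Set.uIcc_of_le zero_le_one]; exact hc.pow 2)

theorem integral_vari_succ {f : ℝ → ℝ} (hf : ContinuousOn f (Set.Icc 0 1)) (γ : ℕ → ℝ) (N : ℕ → ℕ)
    (n : ℕ) : ∫ x in (0 : ℝ)..1, vari f γ N (n + 1) x
      = (1 - γ (n + 1)) ^ 2 * (∫ x in (0 : ℝ)..1, vari f γ N n x)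
        + γ (n + 1) ^ 2 * varZ f (N (n + 1)) := by
  simp only [vari, varZ]
  have h := continuousOn_vari hf γ N n
  have h1 := continuousOn_meanZ hf (N (n + 1))
  have h2 := continuousOn_sqZ hf (N (n + 1))
  rw [intervalIntegral.integral_add, intervalIntegral.integral_const_mul,
    intervalIntegral.integral_const_mul]
  · exact ContinuousOn.intervalIntegrable (by rw [Set.uIcc_of_le zero_le_one]; exact h.const_mul _)
  · exact ContinuousOn.intervalIntegrable (by
      rw [Set.uIcc_of_le zero_le_one]; exact (h2.sub (h1.pow 2)).const_mul _)

/-! ### Rates of the bias and of the variance. -/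

theorem tendstoUniformlyOn_mul_of_bounded {ι : Type*} {S : Set ι} {c : ℕ → ι → ℝ} {c' : ι → ℝ}
    {a : ℕ → ℝ} {l B : ℝ} (hc : TendstoUniformlyOn c c' atTop S) (hB : ∀ x ∈ S, |c' x| ≤ B)
    (ha : Tendsto a atTop (𝓝 l)) :
    TendstoUniformlyOn (fun n x => a n * c n x) (fun x => l * c' x) atTop S := by
  obtain ⟨δ, hδ, hδc⟩ := exists_bound_of_tendstoUniformlyOn hc
  refine tendstoUniformlyOn_of_bound (δ := fun n => |a n| * δ n + |a n - l| * B) ?_ ?_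
  · have h1 := (ha.abs.mul hδ).add ((ha.sub_const l).abs.mul_const B)
    simpa using h1
  · filter_upwards [hδc] with n hn x hx
    have e : a n * c n x - l * c' x = a n * (c n x - c' x) + (a n - l) * c' x := by ring
    rw [e]
    refine (abs_add_le _ _).trans ?_
    rw [abs_mul, abs_mul]
    exact add_le_add (mul_le_mul_of_nonneg_left (hn x hx) (abs_nonneg _))
      (mul_le_mul_of_nonneg_left (hB x hx) (abs_nonneg _))

theorem tendsto_integral_sq_of_tendstoUniformlyOn {r : ℕ → ℝ → ℝ} {r' : ℝ → ℝ}
    (hr : ∀ n, ContinuousOn (r n) (Set.Icc 0 1)) (hr' : ContinuousOn r' (Set.Icc 0 1))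
    (h : TendstoUniformlyOn r r' atTop (Set.Icc 0 1)) :
    Tendsto (fun n => ∫ x in (0 : ℝ)..1, r n x ^ 2) atTop (𝓝 (∫ x in (0 : ℝ)..1, r' x ^ 2)) := by
  obtain ⟨B, hB⟩ := isCompact_Icc.exists_bound_of_continuousOn hr'
  have hsub : Set.uIoc (0 : ℝ) 1 ⊆ Set.Icc 0 1 := by
    rw [Set.uIoc_of_le zero_le_one]; exact Set.Ioc_subset_Icc_self
  refine intervalIntegral.tendsto_integral_filter_of_dominated_convergence
    (fun _ => (B + 1) ^ 2) ?_ ?_ intervalIntegrable_const ?_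
  · exact Eventually.of_forall fun n =>
      (((hr n).mono hsub).pow 2).aestronglyMeasurable measurableSet_uIoc
  · filter_upwards [Metric.tendstoUniformlyOn_iff.1 h 1 one_pos] with n hn
    refine Eventually.of_forall fun x hx => ?_
    rw [norm_pow]
    refine pow_le_pow_left₀ (norm_nonneg _) ?_ 2
    have h1 := hn x (hsub hx)
    rw [dist_comm, dist_eq_norm] at h1
    have h2 := hB x (hsub hx)
    have h3 := norm_le_norm_add_norm_sub' (r n x) (r' x)
    linarith
  · exact Eventually.of_forall fun x hx => (h.tendsto_at (hsub hx)).pow 2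

theorem mul_lt_one_of_lt_lim {γ : ℕ → ℝ} {L : EReal} {τ ξ : ℝ} (hτ : 0 < τ)
    (hL : Tendsto (fun n : ℕ => (((n : ℝ) * γ n : ℝ) : EReal)) atTop (𝓝 L))
    (hτL : (τ : EReal) < L)
    (hξ : Tendsto (fun n : ℕ => ((n : ℝ) * γ n)⁻¹) atTop (𝓝 ξ)) : τ * ξ < 1 := by
  -- A real number strictly between τ and L keeps the inequality strict in the limit and also covers
  -- L = ∞.
  obtain ⟨τ', h1, h2⟩ := EReal.lt_iff_exists_real_btwn.1 hτL
  rw [EReal.coe_lt_coe_iff] at h1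
  have hτ' : 0 < τ' := hτ.trans h1
  have h3 : ξ ≤ τ'⁻¹ := by
    refine le_of_tendsto hξ ?_
    filter_upwards [hL.eventually (lt_mem_nhds h2)] with n hn
    rw [EReal.coe_lt_coe_iff] at hn
    exact inv_anti₀ hτ' hn.le
  calc τ * ξ ≤ τ * τ'⁻¹ := mul_le_mul_of_nonneg_left h3 hτ.le
    _ < 1 := by rw [← div_eq_mul_inv, div_lt_one hτ']; exact h1

theorem tendsto_sum_of_lt_lim {γ : ℕ → ℝ} {L : EReal} {τ : ℝ} (hτ : 0 < τ)
    (hL : Tendsto (fun n : ℕ => (((n : ℝ) * γ n : ℝ) : EReal)) atTop (𝓝 L))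
    (hτL : (τ : EReal) < L) :
    Tendsto (fun n => ∑ i ∈ Finset.range n, γ (i + 1)) atTop atTop := by
  have h1 := (tendsto_add_atTop_nat 1).eventually (hL.eventually (lt_mem_nhds hτL))
  obtain ⟨n₀, h₀⟩ := eventually_atTop.1 h1
  have h2 := tendsto_atTop_add_const_right atTop
    (∑ i ∈ Finset.range n₀, γ (i + 1) - τ * ∑ i ∈ Finset.range n₀, 1 / ((i : ℝ) + 1))
    (Real.tendsto_sum_range_one_div_nat_succ_atTop.const_mul_atTop hτ)
  refine tendsto_atTop_mono' atTop ?_ h2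
  filter_upwards [eventually_ge_atTop n₀] with n hn
  induction n, hn using Nat.le_induction with
  | base => simp
  | succ n hn ih =>
    rw [Finset.sum_range_succ, Finset.sum_range_succ]
    have h3 := h₀ n hn
    rw [EReal.coe_lt_coe_iff] at h3
    push_cast at h3
    have h4 : τ * (1 / ((n : ℝ) + 1)) ≤ γ (n + 1) := by
      rw [mul_one_div, div_le_iff₀ (by positivity)]
      linarith
    linarith

theorem isLittleO_sub_of_tendsto_div {u w : ℕ → ℝ} {c : ℝ} (hw : ∀ n, 1 ≤ n → 0 < w n)
    (h : Tendsto (fun n => u n / w n) atTop (𝓝 c)) :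
    (fun n => u n - c * w n) =o[atTop] w := by
  rw [isLittleO_iff_tendsto']
  · have h1 := h.sub_const c
    rw [sub_self] at h1
    refine h1.congr' ?_
    filter_upwards [eventually_ge_atTop 1] with n hn
    have := (hw n hn).ne'
    field_simp
  · filter_upwards [eventually_ge_atTop 1] with n hn h0
    exact absurd h0 (hw n hn).ne'

section Rates

variable {f : ℝ → ℝ} {γ m : ℕ → ℝ} {N : ℕ → ℕ} {a α ξ : ℝ}

theorem tendsto_half_order (ha : 0 < a) (hm : GS a m)
    (hNm : Tendsto (fun n : ℕ => (N n : ℝ) / m n) atTop (𝓝 1)) :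
    Tendsto (fun n => N n / 2) atTop atTop := by
  have h1 : Tendsto (fun n => m n * ((N n : ℝ) / m n)) atTop atTop :=
    (hm.tendsto_atTop ha).atTop_mul_pos one_pos hNm
  have h2 : Tendsto (fun n => (N n : ℝ)) atTop atTop := by
    refine h1.congr' ?_
    filter_upwards [eventually_ge_atTop 1] with n hn
    have := (hm.1 n hn).ne'
    field_simp
  exact (Nat.tendsto_div_const_atTop (by norm_num)).comp (tendsto_natCast_atTop_iff.1 h2)

theorem tendsto_scaled_bias (hf : ContDiffOn ℝ 4 f (Set.Icc 0 1)) (ha : 0 < a) (hm : GS a m)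
    (hN : ∀ n, 1 ≤ n → 0 < N n ∧ Even (N n))
    (hNm : Tendsto (fun n : ℕ => (N n : ℝ) / m n) atTop (𝓝 1)) {w : ℕ → ℝ} {l : ℝ}
    (hw : Tendsto (fun n => (m n ^ 2)⁻¹ / w n) atTop (𝓝 l)) :
    TendstoUniformlyOn (fun n x => (meanZ f (N n) x - f x) / w n) (fun x => l * (-2 * Δ₂ f x))
      atTop (Set.Icc 0 1) := by
  obtain ⟨B, hB⟩ := isCompact_Icc.exists_bound_of_continuousOn
    ((continuousOn_Δ₂ hf).const_mul (-2))
  have h1 : TendstoUniformlyOn (fun n x => (N n : ℝ) ^ 2 * (meanZ f (N n) x - f x))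
      (fun x => -2 * Δ₂ f x) atTop (Set.Icc 0 1) := by
    rw [Metric.tendstoUniformlyOn_iff]
    intro ε hε
    filter_upwards [(tendsto_half_order ha hm hNm).eventually
      (Metric.tendstoUniformlyOn_iff.1 (tendsto_meanZ_bias hf) ε hε), eventually_ge_atTop 1]
      with n hn hn1
    have := Nat.two_mul_div_two_of_even (hN n hn1).2
    rwa [this] at hn
  have h2 : Tendsto (fun n => (((N n : ℝ) / m n) ^ 2)⁻¹ * ((m n ^ 2)⁻¹ / w n)) atTop (𝓝 l) := by
    simpa using ((hNm.pow 2).inv₀ (by norm_num)).mul hw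
  have h3 := tendstoUniformlyOn_mul_of_bounded h1 hB h2
  refine h3.congr ?_
  filter_upwards [eventually_ge_atTop 1] with n hn x _
  have h4 := (hm.1 n hn).ne'
  have h5 : (N n : ℝ) ≠ 0 := by exact_mod_cast (hN n hn).1.ne'
  simp only
  field_simp

/-- The scale w is left free: l = 1 on the natural scale m⁻², and l = 0 when the bias is measured on
the larger scale of the standard deviation. -/
theorem tendsto_integral_bias_sq (hf : ContDiffOn ℝ 4 f (Set.Icc 0 1)) (ha : 0 < a)
    (hm : GS a m) (hN : ∀ n, 1 ≤ n → 0 < N n ∧ Even (N n))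
    (hNm : Tendsto (fun n : ℕ => (N n : ℝ) / m n) atTop (𝓝 1))
    (hγ : ∀ n, 1 ≤ n → 0 < γ n) (hγ0 : Tendsto γ atTop (𝓝 0))
    (hdiv : Tendsto (fun n => ∑ i ∈ Finset.range n, γ (i + 1)) atTop atTop)
    (hξ : Tendsto (fun n : ℕ => ((n : ℝ) * γ n)⁻¹) atTop (𝓝 ξ)) {w : ℕ → ℝ} {κ l : ℝ}
    (hw : GS (-κ) w) (hκ : 0 < 1 - κ * ξ)
    (hwm : Tendsto (fun n => (m n ^ 2)⁻¹ / w n) atTop (𝓝 l)) :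
    Tendsto (fun n => (∫ x in (0 : ℝ)..1, bias f γ N n x ^ 2) / w n ^ 2) atTop
      (𝓝 (C₂ f * (l * (2 / (1 - κ * ξ))) ^ 2)) := by
  have hc := tendsto_scaled_bias hf ha hm hN hNm hwm
  have hΔ := continuousOn_Δ₂ hf
  have hlc : ContinuousOn (fun x => l * (-2 * Δ₂ f x)) (Set.Icc 0 1) :=
    (hΔ.const_mul _).const_mul _
  have hη : 0 < ((1 : ℕ) : ℝ) - κ * ξ := by simpa using hκ
  have h := tendsto_averaging (u := bias f γ N) (s := 1) hγ hγ0 hdiv hξ hw hη (fun n x _ => by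
      have := (hw.1 (n + 1) (by omega)).ne'
      rw [bias, pow_one]
      field_simp)
    (fun n => isCompact_Icc.exists_bound_of_continuousOn (continuousOn_bias hf.continuousOn γ N n))
    (isCompact_Icc.exists_bound_of_continuousOn hlc) hc
  have h1 := tendsto_integral_sq_of_tendstoUniformlyOn
    (fun n => (continuousOn_bias hf.continuousOn γ N n).div_const _) (hlc.div_const _) h
  have e1 : ∫ x in (0 : ℝ)..1, (l * (-2 * Δ₂ f x) / (((1 : ℕ) : ℝ) - κ * ξ)) ^ 2
      = C₂ f * (l * (2 / (1 - κ * ξ))) ^ 2 := by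
    rw [C₂, ← intervalIntegral.integral_mul_const]
    refine intervalIntegral.integral_congr fun x _ => ?_
    simp only [Nat.cast_one]
    ring
  rw [e1] at h1
  refine h1.congr fun n => ?_
  rw [← intervalIntegral.integral_div]
  refine intervalIntegral.integral_congr fun x _ => ?_
  simp only [div_pow]

theorem tendsto_varZ_order (hf : ContinuousOn f (Set.Icc 0 1)) (ha : 0 < a) (hm : GS a m)
    (hN : ∀ n, 1 ≤ n → 0 < N n ∧ Even (N n))
    (hNm : Tendsto (fun n : ℕ => (N n : ℝ) / m n) atTop (𝓝 1)) :
    Tendsto (fun n => varZ f (N n) / √(m n)) atTop (𝓝 (C₁ f * C₃)) := by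
  have h1 := ((tendsto_varZ hf).comp (tendsto_half_order ha hm hNm)).mul hNm.sqrt
  rw [Real.sqrt_one, mul_one] at h1
  refine h1.congr' ?_
  filter_upwards [eventually_ge_atTop 1] with n hn
  have h2 := hm.1 n hn
  have h3 : (0 : ℝ) < N n := by exact_mod_cast (hN n hn).1
  have h4 : √(N n : ℝ) ≠ 0 := (Real.sqrt_pos.2 h3).ne'
  simp only [Function.comp_apply]
  rw [Nat.two_mul_div_two_of_even (hN n hn).2, Real.sqrt_div h3.le]
  field_simp

/-- Again w is free: l = 1 on the scale γ√m, and l = 0 on the larger scale m⁻⁴ when the squared bias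
dominates. -/
theorem tendsto_integral_vari (hf : ContinuousOn f (Set.Icc 0 1)) (ha : 0 < a)
    (hm : GS a m) (hN : ∀ n, 1 ≤ n → 0 < N n ∧ Even (N n))
    (hNm : Tendsto (fun n : ℕ => (N n : ℝ) / m n) atTop (𝓝 1))
    (hγ : ∀ n, 1 ≤ n → 0 < γ n) (hγ0 : Tendsto γ atTop (𝓝 0))
    (hdiv : Tendsto (fun n => ∑ i ∈ Finset.range n, γ (i + 1)) atTop atTop)
    (hξ : Tendsto (fun n : ℕ => ((n : ℝ) * γ n)⁻¹) atTop (𝓝 ξ)) {w : ℕ → ℝ} {κ l : ℝ}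
    (hw : GS (-κ) w) (hκ : 0 < 2 - κ * ξ)
    (hwm : Tendsto (fun n => γ n * √(m n) / w n) atTop (𝓝 l)) :
    Tendsto (fun n => (∫ x in (0 : ℝ)..1, vari f γ N n x) / w n) atTop
      (𝓝 (l * (C₁ f * C₃) / (2 - κ * ξ))) := by
  have h1 := hwm.mul (tendsto_varZ_order hf ha hm hN hNm)
  have hη : 0 < ((2 : ℕ) : ℝ) - κ * ξ := by simpa using hκ
  have h := tendsto_averaging_real (u := fun n => ∫ x in (0 : ℝ)..1, vari f γ N n x) (s := 2)
    hγ hγ0 hdiv hξ hw hη (fun n => by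
      have h2 := (hw.1 (n + 1) (by omega)).ne'
      have h3 := (Real.sqrt_pos.2 (hm.1 (n + 1) (by omega))).ne'
      rw [integral_vari_succ hf]
      field_simp) h1
  simpa using h

end Rates

end RecBernstein

/-! ### The three regimes. -/

theorem proposition3
    {Ω : Type*} [MeasurableSpace Ω] (P : Measure Ω) [IsProbabilityMeasure P]
    -- the density `f` on `[0,1]`; assumption (A1)
    (f : ℝ → ℝ) (hf_nonneg : ∀ x ∈ Set.Icc (0 : ℝ) 1, 0 ≤ f x)
    (hA1 : ContDiffOn ℝ 4 f (Set.Icc 0 1))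
    -- `X 1, X 2, …` are i.i.d. with density `f` supported on `[0,1]`
    (X : ℕ → Ω → ℝ) (hX_meas : ∀ n, 1 ≤ n → Measurable (X n))
    (hX_indep : iIndepFun (fun n : ℕ => X (n + 1)) P)
    (hX_law : ∀ n, 1 ≤ n → P.map (X n) =
      (volume.restrict (Set.Icc (0 : ℝ) 1)).withDensity (fun x => ENNReal.ofReal (f x)))
    -- assumption (A2)
    (α : ℝ) (hα : 1 / 2 < α ∧ α ≤ 1)
    (γ : ℕ → ℝ) (hA2 : RecBernstein.GS (-α) γ)
    -- assumption (A3), with `N n` the even positive integer used as order, `N n ∼ m n`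
    (a : ℝ) (ha : 0 < a ∧ a < 1)
    (m : ℕ → ℝ) (hA3 : RecBernstein.GS a m)
    (N : ℕ → ℕ) (hN : ∀ n, 1 ≤ n → 0 < N n ∧ Even (N n))
    (hNm : Tendsto (fun n : ℕ => (N n : ℝ) / m n) atTop (𝓝 1))
    -- assumption (A4): `n γ_n` has a limit `L`, possibly `+∞`, above the threshold
    (L : EReal) (hL : Tendsto (fun n : ℕ => (((n : ℝ) * γ n : ℝ) : EReal)) atTop (𝓝 L))
    (hA4 : ((min (2 * a) ((2 * α - a) / 4) : ℝ) : EReal) < L)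
    (ξ : ℝ) (hξ : Tendsto (fun n : ℕ => ((n : ℝ) * γ n)⁻¹) atTop (𝓝 ξ)) :
    -- the error is integrable, so that the MISE is well defined and finite
    (∀ n : ℕ, Integrable
      (fun q : Ω × ℝ => (RecBernstein.estimator γ N (fun i => X i q.1) n q.2 - f q.2) ^ 2)
      (P.prod (volume.restrict (Set.Icc (0 : ℝ) 1)))) ∧
    (a < 2 / 9 * α →
      (fun n : ℕ => RecBernstein.MISE P f X γ N n
          - RecBernstein.C₂ f * (m n ^ 4)⁻¹ * (4 / (1 - 2 * a * ξ) ^ 2))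
        =o[atTop] fun n : ℕ => (m n ^ 4)⁻¹) ∧
    (a = 2 / 9 * α →
      (fun n : ℕ => RecBernstein.MISE P f X γ N n
          - (RecBernstein.C₂ f * (m n ^ 4)⁻¹ * (4 / (1 - 2 * a * ξ) ^ 2)
            + RecBernstein.C₁ f * RecBernstein.C₃ * (γ n * √(m n))
              * (2 / (4 - (2 * α - a) * ξ))))
        =o[atTop] fun n : ℕ => (m n ^ 4)⁻¹ + γ n * √(m n)) ∧
    (2 / 9 * α < a →
      (fun n : ℕ => RecBernstein.MISE P f X γ N n
          - RecBernstein.C₁ f * RecBernstein.C₃ * (γ n * √(m n))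
            * (2 / (4 - (2 * α - a) * ξ)))
        =o[atTop] fun n : ℕ => γ n * √(m n)) := by
  have hf := hA1.continuousOn
  have hγ := hA2.1
  have hγ0 : Tendsto γ atTop (𝓝 0) := hA2.tendsto_zero (by linarith [hα.1])
  have ha0 := ha.1
  have hτ1 : 0 < 2 * a := by linarith
  have hτ2 : 0 < (2 * α - a) / 4 := by linarith [hα.1, ha.2]
  have hdiv := RecBernstein.tendsto_sum_of_lt_lim (lt_min hτ1 hτ2) hL hA4
  have hw1 : RecBernstein.GS (-(2 * a)) fun n => (m n ^ 2)⁻¹ := (hA3.pow 2).inv.congr (by simp) fun _ _ => rfl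
  have hw2 : RecBernstein.GS (-(4 * a)) fun n => (m n ^ 4)⁻¹ := (hA3.pow 4).inv.congr (by simp) fun _ _ => rfl
  have hw3 : RecBernstein.GS (-((2 * α - a) / 2)) fun n => γ n * √(m n) :=
    (hA2.mul hA3.sqrt).congr (by ring) fun _ _ => rfl
  have hw4 : RecBernstein.GS (-((2 * α - a) / 4)) fun n => √(γ n * √(m n)) :=
    hw3.sqrt.congr (by ring) fun _ _ => rfl
  have hMISE := fun n => RecBernstein.MISE_eq (γ := γ) (N := N) hf_nonneg hf hX_meas hX_indep hX_law n
  -- squared bias and variance at their natural rates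
  have hbias : 0 < 1 - 2 * a * ξ → (fun n => (∫ x in (0 : ℝ)..1, RecBernstein.bias f γ N n x ^ 2)
      - RecBernstein.C₂ f * (m n ^ 4)⁻¹ * (4 / (1 - 2 * a * ξ) ^ 2)) =o[atTop] fun n => (m n ^ 4)⁻¹ := by
    intro hκ
    have h := RecBernstein.tendsto_integral_bias_sq (f := f) (N := N) (l := 1) hA1 ha0 hA3 hN hNm hγ hγ0 hdiv hξ
      hw1 hκ (tendsto_const_nhds.congr' (by
        filter_upwards [eventually_ge_atTop 1] with n hn
        exact (div_self (hw1.1 n hn).ne').symm))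
    rw [one_mul] at h
    have h1 := RecBernstein.isLittleO_sub_of_tendsto_div (w := fun n => (m n ^ 4)⁻¹) hw2.1
      (h.congr fun n => by rw [inv_pow, ← pow_mul])
    refine h1.congr_left fun n => ?_
    rw [div_pow]
    ring
  have hvar : 0 < 2 - (2 * α - a) / 2 * ξ → (fun n => (∫ x in (0 : ℝ)..1, RecBernstein.vari f γ N n x)
      - RecBernstein.C₁ f * RecBernstein.C₃ / (2 - (2 * α - a) / 2 * ξ) * (γ n * √(m n)))
        =o[atTop] fun n => γ n * √(m n) := by
    intro hκ
    have h := RecBernstein.tendsto_integral_vari (f := f) (N := N) (l := 1) hf ha0 hA3 hN hNm hγ hγ0 hdiv hξ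
      hw3 hκ (tendsto_const_nhds.congr' (by
        filter_upwards [eventually_ge_atTop 1] with n hn
        exact (div_self (hw3.1 n hn).ne').symm))
    rw [one_mul] at h
    exact RecBernstein.isLittleO_sub_of_tendsto_div hw3.1 h
  have hvar_eq : RecBernstein.C₁ f * RecBernstein.C₃ / (2 - (2 * α - a) / 2 * ξ)
      = RecBernstein.C₁ f * RecBernstein.C₃ * (2 / (4 - (2 * α - a) * ξ)) := by
    rw [show 2 - (2 * α - a) / 2 * ξ = (4 - (2 * α - a) * ξ) / 2 by ring, div_div_eq_mul_div,
      mul_div_assoc]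
  refine ⟨fun n => RecBernstein.integrable_sq_error hf hX_meas n, fun hlt => ?_, fun heq => ?_, fun hgt => ?_⟩
  -- For a ≤ 2α/9 the minimum is 2a, so the threshold yields exactly 2aξ < 1.
  · rw [min_eq_left (by linarith)] at hA4
    have hξ1 := RecBernstein.mul_lt_one_of_lt_lim hτ1 hL hA4 hξ
    -- The variance is averaged on the scale m⁻⁴, whose constant 2 - 4aξ is positive here. Its own
    -- scale would need (2α-a)ξ < 4, which the threshold does not give in this case.
    have hV : Tendsto (fun n => γ n * √(m n) / (m n ^ 4)⁻¹) atTop (𝓝 0) :=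
      (hw3.mul hw2.inv).tendsto_zero (by linarith)
    have h := RecBernstein.tendsto_integral_vari (f := f) (N := N) hf ha0 hA3 hN hNm hγ hγ0 hdiv hξ
      hw2 (by linarith) hV
    rw [zero_mul, zero_div] at h
    have h1 := RecBernstein.isLittleO_sub_of_tendsto_div hw2.1 h
    refine ((hbias (by linarith)).add h1).congr_left fun n => ?_
    rw [hMISE]
    ring
  · rw [min_eq_left (by linarith)] at hA4
    have hξ1 := RecBernstein.mul_lt_one_of_lt_lim hτ1 hL hA4 hξ
    -- At equality (2α-a)/4 = 2a, so both natural scales are admissible at once.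
    have hξ2 : (2 * α - a) / 4 * ξ < 1 := by
      rwa [show (2 * α - a) / 4 = 2 * a by linarith]
    have h1 := hbias (by linarith)
    have h2 := hvar (by linarith)
    rw [hvar_eq] at h2
    have hO : ∀ u v : ℕ → ℝ, (∀ n, 1 ≤ n → 0 < u n) → (∀ n, 1 ≤ n → 0 < v n) →
        u =O[atTop] fun n => u n + v n := fun u v hu hv => by
      refine IsBigO.of_bound 1 ?_
      filter_upwards [eventually_ge_atTop 1] with n hn
      have := hu n hn
      have := hv n hn
      rw [one_mul, Real.norm_of_nonneg (by positivity), Real.norm_of_nonneg (by positivity)]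
      linarith
    have hO1 := hO _ _ hw2.1 hw3.1
    have hO2 := hO _ _ hw3.1 hw2.1
    simp only [add_comm (γ _ * √(m _))] at hO2
    refine ((h1.trans_isBigO hO1).add (h2.trans_isBigO hO2)).congr_left fun n => ?_
    rw [hMISE]
    ring
  · rw [min_eq_right (by linarith)] at hA4
    have hξ2 := RecBernstein.mul_lt_one_of_lt_lim hτ2 hL hA4 hξ
    -- Symmetrically, the bias is averaged on the scale √(γ√m), for which the threshold gives 1 -
    -- (2α-a)ξ/4 > 0; positivity of 1 - 2aξ is not available.
    have hB : Tendsto (fun n => (m n ^ 2)⁻¹ / √(γ n * √(m n))) atTop (𝓝 0) :=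
      (hw1.mul hw4.inv).tendsto_zero (by linarith)
    have h := RecBernstein.tendsto_integral_bias_sq (f := f) (N := N) hA1 ha0 hA3 hN hNm hγ hγ0 hdiv hξ
      hw4 (by linarith) hB
    simp only [zero_mul, ne_eq, OfNat.ofNat_ne_zero, not_false_eq_true, zero_pow, mul_zero] at h
    have h1 := RecBernstein.isLittleO_sub_of_tendsto_div hw3.1 (h.congr' (by
      filter_upwards [eventually_ge_atTop 1] with n hn
      rw [Real.sq_sqrt (hw3.1 n hn).le]))
    have h2 := hvar (by linarith)
    rw [hvar_eq] at h2
    refine (h1.add h2).congr_left fun n => ?_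
    rw [hMISE]
    ring
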